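/- Theorem. Let $X_1, X_2, \ldots$ be independent real random variables with a common continuous distribution (that is, $\mathbb{P}(X_1 = x) = 0$ for every $x \in \mathbb{R}$), such that $\mathbb{E} X_1 := \mathbb{E} X_1^+ - \mathbb{E} X_1^- \in (-\infty, \infty]$ (that is, $\mathbb{E} X_1^- < \infty$). Let $S_0 = 0$ and $S_j = X_1 + \cdots + X_j$. Almost surely there is a greatest convex function $C : [0,\infty) \to \mathbb{R}$ with $C(j) \le S_j$ for all integers $j \ge 0$; it is called the convex minorant of the walk on $[0,\infty)$. A face of $C$ is a pair of successive indices $k < k + j$ at which $S$ and $C$ agree; its length is $j$ and its increment is $S_{k+j} - S_k$. Then the point process of the lengths and increments of the faces of $C$ is a Poisson point process on $\{1, 2, \ldots\} \times \mathbb{R}$ with intensity $$ j^{-1}\, \mathbb{P}(S_j \in dx), \qquad j = 1, 2, \ldots, \quad \frac{x}{j} < \mathbb{E} X_1, $$ and zero intensity where $x / j \ge \mathbb{E} X_1$. -/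

import Mathlib

open MeasureTheory ProbabilityTheory Set
open scoped ENNReal

namespace RandomWalkMinorant

/-! ### Poisson point processes -/

/-- The Poisson distribution on `[0, ∞]` with parameter `r ∈ [0, ∞]`; for `r = ∞` it is the point
mass at `∞`. -/
noncomputable def extendedPoisson (r : ℝ≥0∞) : Measure ℝ≥0∞ :=
  if r = ∞ then Measure.dirac ∞
  else (poissonMeasure r.toNNReal).map (fun n : ℕ => (n : ℝ≥0∞))

/-- The random measure `N` is a Poisson point process with intensity measure `μ`: the number of
points in any measurable set is Poisson, and the numbers of points in finitely many pairwise
disjoint measurable sets are independent. -/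
structure IsPoissonPointProcess {Ω E : Type*} [MeasurableSpace Ω] [MeasurableSpace E]
    (P : Measure Ω) (μ : Measure E) (N : Ω → Measure E) : Prop where
  aemeasurable : AEMeasurable N P
  hasLaw : ∀ A : Set E, MeasurableSet A → HasLaw (fun ω => N ω A) (extendedPoisson (μ A)) P
  indep : ∀ (n : ℕ) (A : Fin n → Set E), (∀ i, MeasurableSet (A i)) →
    Pairwise (fun i j => Disjoint (A i) (A j)) → iIndepFun (fun i ω => N ω (A i)) P

/-! ### The greatest convex minorant of a sequence and its faces -/

/-- `f` is convex on `[0, ∞)` and lies below the sequence `s` at the nonnegative integers. -/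
def IsConvexBelow (s : ℕ → ℝ) (f : ℝ → ℝ) : Prop :=
  ConvexOn ℝ (Ici 0) f ∧ ∀ n : ℕ, f n ≤ s n

/-- `c` is, on `[0, ∞)`, the greatest convex function below `s`. -/
def IsGreatestConvexMinorant (s : ℕ → ℝ) (c : ℝ → ℝ) : Prop :=
  IsConvexBelow s c ∧ ∀ f : ℝ → ℝ, IsConvexBelow s f → ∀ t : ℝ, 0 ≤ t → f t ≤ c t

/-- The convex minorant of `s` on `[0, ∞)`: the pointwise supremum of the convex functions
below `s`. It has a junk value if there is no such function. -/
noncomputable def convexMinorant (s : ℕ → ℝ) (t : ℝ) : ℝ :=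
  sSup {y : ℝ | ∃ f : ℝ → ℝ, IsConvexBelow s f ∧ y = f t}

/-- The sequence meets its convex minorant at the index `k`. -/
def IsVertex (s : ℕ → ℝ) (k : ℕ) : Prop :=
  s k = convexMinorant s k

/-- The pairs `(k, j)` such that `k` and `k + j` are successive indices at which `s` meets its
convex minorant: the face that starts at `k` and has length `j`. -/
def faces (s : ℕ → ℝ) : Set (ℕ × ℕ+) :=
  {p | IsVertex s p.1 ∧ IsVertex s (p.1 + p.2) ∧ ∀ i, p.1 < i → i < p.1 + p.2 → ¬ IsVertex s i}

/-- Sets of positive integers are all measurable. -/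
instance : MeasurableSpace ℕ+ := ⊤

instance : DiscreteMeasurableSpace ℕ+ := ⟨fun _ => trivial⟩

/-- The point process of lengths and increments of the faces: one unit mass at
`(j, s (k + j) - s k)` for each face `(k, j)`. -/
noncomputable def faceProcess (s : ℕ → ℝ) : Measure (ℕ+ × ℝ) :=
  Measure.sum fun p : faces s =>
    Measure.dirac (p.1.2, s (p.1.1 + p.1.2) - s p.1.1)

/-! ### The random walk -/

/-- `S_0 = 0` and `S_n` is the sum of the first `n` increments. -/
def walk {Ω : Type*} (X : ℕ → Ω → ℝ) (n : ℕ) (ω : Ω) : ℝ :=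
  ∑ i ∈ Finset.range n, X i ω

/-- The expectation `E Y⁺ - E Y⁻`, meaningful as soon as one of the two terms is finite. -/
noncomputable def extendedExpectation {Ω : Type*} [MeasurableSpace Ω] (P : Measure Ω)
    (Y : Ω → ℝ) : EReal :=
  ((∫⁻ ω, ENNReal.ofReal (Y ω) ∂P : ℝ≥0∞) : EReal) -
    ((∫⁻ ω, ENNReal.ofReal (-Y ω) ∂P : ℝ≥0∞) : EReal)

/-- The measure `j⁻¹ P(S_j ∈ dx)` on `{(j, x) : j ≥ 1, x / j < m}`. -/
noncomputable def faceIntensity {Ω : Type*} [MeasurableSpace Ω] (P : Measure Ω)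
    (X : ℕ → Ω → ℝ) (m : EReal) : Measure (ℕ+ × ℝ) :=
  Measure.sum fun j : ℕ+ =>
    (((j : ℕ) : ℝ≥0∞)⁻¹ •
      (P.map (walk X j)).restrict {x : ℝ | ((x / (j : ℕ) : ℝ) : EReal) < m}).map
        (fun x => (j, x))

end RandomWalkMinorant

namespace RandomWalkMinorant

/-! The point process is identified by its Laplace functional, which exact combinatorics gives for
finite walks. For a weight `g`, let φ_n be the mean, over the walk on [0, n], of the product of `g`
(length, increment) over its faces, and let ψ_j be the mean of `g j S_j`. Ties between slopes have
probability 0 (`ae_isGeneric`), and then the face lengths add up to n. So n φ_n is the sum over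
positions k and lengths j of j times the mean of the product on the event that [k, k + j) is a face.
Moving this block to the front preserves the law. The block is a face exactly when it is an
excursion above its chord and k is the place where the rest of the walk, tilted by the slope of the
block, is minimal; the other faces are those of the rest. Exactly one k is that place and, by the
cycle lemma, exactly one of the j rotations of a block is an excursion. Hence n φ_n = ∑_j ψ_j
φ_{n-j} (`mul_meanFaceProd`), that is, ∑ φ_n q^n = exp(∑ ψ_j q^j / j), and one lets q tend to 1
(`one_add_tsum_eq_exp`).

For the infinite walk and a < E X_1, the faces of slope less than a are the faces up to the time n
at which S_i - a i is minimal. The product over the faces of [0, n] is independent of the event that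
the later walk stays above slope a. So the Laplace functional of these faces is p ∑ φ_n, with the
weight cut to slopes less than a and with p free of the weight. The weight 1 determines p, and the
quotient of two exponentials is the Poisson formula (`lintegral_faces_slope_lt`).

Finally a increases to E X_1. Almost surely every face has slope less than the mean, because a walk
with finite mean m does not stay above the line of slope m (`iidLaw_staysAbove_eq_zero`). Laplace
transforms determine laws on [0, ∞]^n (`ext_of_lintegral_expNeg`), which yields the Poisson counts
and their independence together. -/

/-! ### Strict faces of finite sequences -/

/-- All points of `s` with index in `D`, except those at `k` and `k + j`, lie strictly above the
line through the points at `k` and `k + j`. -/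
def IsStrictFace (D : Set ℕ) (s : ℕ → ℝ) (k j : ℕ) : Prop :=
  ∀ i ∈ D, i ≠ k → i ≠ k + j → s k + (s (k + j) - s k) / j * ((i : ℝ) - k) < s i

lemma IsStrictFace.mono {D D' : Set ℕ} {s : ℕ → ℝ} {k j : ℕ} (h : IsStrictFace D s k j)
    (hD : D' ⊆ D) : IsStrictFace D' s k j :=
  fun i hi => h i (hD hi)

/-- An affine description of strict faces. -/
lemma isStrictFace_iff {D : Set ℕ} {s : ℕ → ℝ} {k j : ℕ} (hj : 0 < j) {m : ℝ}
    (hm : s (k + j) = s k + m * j) :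
    IsStrictFace D s k j ↔ ∀ i ∈ D, i ≠ k → i ≠ k + j → s k + m * ((i : ℝ) - k) < s i := by
  have : (s (k + j) - s k) / j = m := by
    have : (j : ℝ) ≠ 0 := by positivity
    rw [hm]; field_simp; ring
  simp only [IsStrictFace, this]

lemma slope_spec (s : ℕ → ℝ) (k : ℕ) {j : ℕ} (hj : 0 < j) :
    s (k + j) = s k + (s (k + j) - s k) / j * j := by
  have : (j : ℝ) ≠ 0 := by positivity
  field_simp; ring

lemma isStrictFace_tilt {D : Set ℕ} {s : ℕ → ℝ} {k j : ℕ} (hj : 0 < j) (a b : ℝ) :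
    IsStrictFace D (fun i => s i - (a + b * i)) k j ↔ IsStrictFace D s k j := by
  have h1 := slope_spec s k hj
  rw [isStrictFace_iff hj h1, isStrictFace_iff (m := (s (k + j) - s k) / j - b) hj]
  · refine forall₄_congr fun i _ _ _ => ?_
    constructor <;> intro h <;> linarith
  · push_cast; linear_combination h1

open Classical in
/-- The strict faces of the sequence `s` on `[0, n]`. -/
noncomputable def finiteFaces (n : ℕ) (s : ℕ → ℝ) : Finset (ℕ × ℕ) :=
  (Finset.range (n + 1) ×ˢ Finset.range (n + 1)).filter
    fun p => 0 < p.2 ∧ p.1 + p.2 ≤ n ∧ IsStrictFace (Iic n) s p.1 p.2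

lemma mem_finiteFaces {n : ℕ} {s : ℕ → ℝ} {p : ℕ × ℕ} :
    p ∈ finiteFaces n s ↔ 0 < p.2 ∧ p.1 + p.2 ≤ n ∧ IsStrictFace (Iic n) s p.1 p.2 := by
  simp only [finiteFaces, Finset.mem_filter, Finset.mem_product, Finset.mem_range]
  exact ⟨fun h => h.2, fun h => ⟨by omega, h⟩⟩

/-- The sequence obtained by deleting the increments with index in `[k, k + j)`. -/
noncomputable def removeBlock (s : ℕ → ℝ) (k j : ℕ) (i : ℕ) : ℝ :=
  if i ≤ k then s i else s (i + j) - (s (k + j) - s k)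

/-! ### Faces that survive the removal of a face lying at level 0. -/

section Level

variable {t : ℕ → ℝ} {n k₀ j₀ : ℕ}

/-- Two strict faces cannot overlap: the points at `k₀` and `k₀ + j₀` are at the lowest level 0, and
the line of an overlapping face would pass at or above 0 at one of them, which should lie strictly
above that line. -/
lemma strictFace_disjoint_of_level (hj₀ : 0 < j₀) (hn : k₀ + j₀ ≤ n) (h0 : t k₀ = 0)
    (h1 : t (k₀ + j₀) = 0) (hpos : ∀ i ≤ n, i ≠ k₀ → i ≠ k₀ + j₀ → 0 < t i) {k j : ℕ}
    (hj : 0 < j) (hkn : k + j ≤ n) (h : IsStrictFace (Iic n) t k j) :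
    (k = k₀ ∧ j = j₀) ∨ k + j ≤ k₀ ∨ k₀ + j₀ ≤ k := by
  have hm := slope_spec t k hj
  set m := (t (k + j) - t k) / j
  rw [isStrictFace_iff hj hm] at h
  by_contra! hc
  obtain ⟨hc1, hc2, hc3⟩ := hc
  have hnn : ∀ i ≤ n, 0 ≤ t i := fun i hi => by
    by_cases e1 : i = k₀
    · rw [e1, h0]
    by_cases e2 : i = k₀ + j₀
    · rw [e2, h1]
    exact (hpos i hi e1 e2).le
  have a1 := hnn k (by omega)
  have a2 := hnn (k + j) (by omega)
  have hjR : (0 : ℝ) < j := by exact_mod_cast hj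
  -- the line is nonnegative between `k` and `k + j`
  have hline : ∀ i, k < i → i < k + j → 0 ≤ t k + m * ((i : ℝ) - k) := fun i h1 h2 => by
    have e1 : (k : ℝ) < i := by exact_mod_cast h1
    have e2 : (i : ℝ) < k + j := by exact_mod_cast h2
    rcases le_total 0 m with hm0 | hm0 <;> nlinarith
  rcases lt_trichotomy k k₀ with hk | hk | hk
  · have := h k₀ (by simp; omega) (by omega) (by omega)
    have := hline k₀ hk (by omega)
    linarith
  · subst hk
    have hjj := hc1 rfl
    rcases lt_or_gt_of_ne hjj with hlt | hlt
    · have b1 := hpos (k + j) hkn (by omega) (by omega)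
      have b2 := h (k + j₀) (by simp; omega) (by omega) (by omega)
      rw [h1, h0] at b2
      rw [h0] at hm
      have : (0:ℝ) < m := by
        by_contra hneg; nlinarith
      push_cast at b2
      have : (0:ℝ) < j₀ := by exact_mod_cast hj₀
      nlinarith
    · have := h (k + j₀) (by simp; omega) (by omega) (by omega)
      have := hline (k + j₀) (by omega) (by omega)
      linarith
  · have b1 := hpos k (by omega) (by omega) (by omega)
    have b2 : m < 0 := by
      by_cases e : k + j = k₀ + j₀
      · rw [e, h1] at hm
        by_contra hneg; push Not at hneg; nlinarith
      · have b3 := h (k₀ + j₀) (by simp; omega) (by omega) (by omega)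
        rw [h1] at b3
        have : (k : ℝ) < (k₀ + j₀ : ℕ) := by exact_mod_cast hc3
        by_contra hneg; push Not at hneg; nlinarith
    have b3 := h k₀ (by simp; omega) (by omega) (by omega)
    rw [h0] at b3
    have : (k₀ : ℝ) < k := by exact_mod_cast hk
    nlinarith

/-- After the removal, the point at `k₀` is still at level 0. A face straddling it has positive
endpoints, so its line would be positive there. -/
lemma strictFace_removeBlock_disjoint_of_level (hn : k₀ + j₀ ≤ n) (h0 : t k₀ = 0)
    (h1 : t (k₀ + j₀) = 0) (hpos : ∀ i ≤ n, i ≠ k₀ → i ≠ k₀ + j₀ → 0 < t i) {k j : ℕ}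
    (hj : 0 < j) (hkn : k + j ≤ n - j₀)
    (h : IsStrictFace (Iic (n - j₀)) (removeBlock t k₀ j₀) k j) :
    k + j ≤ k₀ ∨ k₀ ≤ k := by
  have hm := slope_spec (removeBlock t k₀ j₀) k hj
  set m := (removeBlock t k₀ j₀ (k + j) - removeBlock t k₀ j₀ k) / j
  rw [isStrictFace_iff hj hm] at h
  by_contra! hc
  have hb := h k₀ (by simp; omega) (by omega) (by omega)
  have a1 : 0 < removeBlock t k₀ j₀ k := by
    rw [removeBlock, if_pos (by omega)]; exact hpos k (by omega) (by omega) (by omega)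
  have a2 : 0 < removeBlock t k₀ j₀ (k + j) := by
    rw [removeBlock, if_neg (by omega), h0, h1, sub_self, sub_zero]
    exact hpos _ (by omega) (by omega) (by omega)
  have a3 : removeBlock t k₀ j₀ k₀ = 0 := by simp [removeBlock, h0]
  rw [a3] at hb
  have e1 : (k : ℝ) < k₀ := by exact_mod_cast hc.2
  have e2 : (k₀ : ℝ) < k + j := by exact_mod_cast hc.1
  rcases le_total 0 m with hm0 | hm0 <;> nlinarith

/-- A face to the left of `k₀` starts at a positive height and its line is at most 0 at `k₀`, so its
slope is negative. Beyond `k₀` the line is negative and both sequences are nonnegative; only the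
indices up to `k₀`, common to both sequences, impose a condition. -/
lemma strictFace_left_iff_of_level (hj₀ : 0 < j₀) (hn : k₀ + j₀ ≤ n) (h0 : t k₀ = 0)
    (h1 : t (k₀ + j₀) = 0) (hpos : ∀ i ≤ n, i ≠ k₀ → i ≠ k₀ + j₀ → 0 < t i) {k j : ℕ}
    (hj : 0 < j) (hk : k + j ≤ k₀) :
    IsStrictFace (Iic n) t k j ↔ IsStrictFace (Iic (n - j₀)) (removeBlock t k₀ j₀) k j := by
  have r1 : ∀ i ≤ k₀, removeBlock t k₀ j₀ i = t i := fun i hi => by simp [removeBlock, hi]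
  have r2 : ∀ i, k₀ < i → removeBlock t k₀ j₀ i = t (i + j₀) := fun i hi => by
    simp [removeBlock, hi.not_ge, h0, h1]
  have hm := slope_spec t k hj
  set m := (t (k + j) - t k) / j
  rw [isStrictFace_iff hj hm, isStrictFace_iff (m := m) hj
    (by rw [r1 _ hk, r1 _ (by omega)]; exact hm)]
  have hjR : (0 : ℝ) < j := by exact_mod_cast hj
  have hj₀R : (0 : ℝ) < j₀ := by exact_mod_cast hj₀
  have hkpos := hpos k (by omega) (by omega) (by omega)
  have hkR : (k : ℝ) < k₀ := by exact_mod_cast (by omega : k < k₀)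
  -- the line is nonpositive at `k₀`
  have key : ∀ (P : Prop), (k + j ≠ k₀ → t k + m * ((k₀ : ℝ) - k) < 0) →
      (m < 0 → t k + m * ((k₀ : ℝ) - k) ≤ 0 → P) → P := fun P hP hQ => by
    have hle : t k + m * ((k₀ : ℝ) - k) ≤ 0 := by
      by_cases e : k + j = k₀
      · rw [← e] at h0 ⊢; push_cast; rw [h0] at hm; linarith
      · exact (hP e).le
    exact hQ (by by_contra hneg; push Not at hneg; nlinarith) hle
  constructor
  · intro h
    refine key _ (fun e => ?_) fun hm0 hle i hi e1 e2 => ?_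
    · have := h k₀ (by simp; omega) (by omega) (by omega); rwa [h0] at this
    rw [r1 k (by omega)]
    by_cases hik : i ≤ k₀
    · rw [r1 i hik]; exact h i (by simp at hi ⊢; omega) e1 e2
    · rw [r2 i (by omega)]
      have := hpos (i + j₀) (by simp at hi; omega) (by omega) (by omega)
      have : (k₀ : ℝ) < i := by exact_mod_cast (by omega : k₀ < i)
      nlinarith
  · intro h
    refine key _ (fun e => ?_) fun hm0 hle i hi e1 e2 => ?_
    · have := h k₀ (by simp; omega) (by omega) (by omega)
      rwa [r1 k (by omega), r1 k₀ le_rfl, h0] at this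
    rw [mem_Iic] at hi
    by_cases hik : i ≤ k₀
    · have := h i (by simp; omega) e1 e2
      rwa [r1 k (by omega), r1 i hik] at this
    have hiR : (k₀ : ℝ) < i := by exact_mod_cast (by omega : k₀ < i)
    have hnn : 0 ≤ t i := by
      by_cases e : i = k₀ + j₀
      · rw [e, h1]
      · exact (hpos i hi (by omega) e).le
    nlinarith

/-- Mirror image of the left case: the slope is positive, so the indices before the gluing point
impose no condition. -/
lemma strictFace_right_iff_of_level (hj₀ : 0 < j₀) (hn : k₀ + j₀ ≤ n) (h0 : t k₀ = 0)
    (h1 : t (k₀ + j₀) = 0) (hpos : ∀ i ≤ n, i ≠ k₀ → i ≠ k₀ + j₀ → 0 < t i) {k j : ℕ}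
    (hj : 0 < j) (hk : k₀ ≤ k) (hkn : k + j ≤ n - j₀) :
    IsStrictFace (Iic n) t (k + j₀) j ↔
      IsStrictFace (Iic (n - j₀)) (removeBlock t k₀ j₀) k j := by
  have r1 : ∀ i ≤ k₀, removeBlock t k₀ j₀ i = t i := fun i hi => by simp [removeBlock, hi]
  have r2 : ∀ i, k₀ ≤ i → removeBlock t k₀ j₀ i = t (i + j₀) := fun i hi => by
    rcases hi.eq_or_lt with rfl | hi
    · rw [r1 _ le_rfl, h0, h1]
    simp [removeBlock, hi.not_ge, h0, h1]
  have hm := slope_spec t (k + j₀) hj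
  set m := (t (k + j₀ + j) - t (k + j₀)) / j
  rw [isStrictFace_iff hj hm, isStrictFace_iff (m := m) hj
    (by rw [r2 _ hk, r2 _ (by omega), show k + j + j₀ = k + j₀ + j by omega]; exact hm)]
  have hjR : (0 : ℝ) < j := by exact_mod_cast hj
  have hj₀R : (0 : ℝ) < j₀ := by exact_mod_cast hj₀
  have hkpos := hpos (k + j₀ + j) (by omega) (by omega) (by omega)
  have hkR : (k₀ : ℝ) ≤ k := by exact_mod_cast hk
  have hnn : ∀ i ≤ n, 0 ≤ t i := fun i hi => by
    by_cases e1 : i = k₀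
    · rw [e1, h0]
    by_cases e2 : i = k₀ + j₀
    · rw [e2, h1]
    exact (hpos i hi e1 e2).le
  have key : ∀ (P : Prop), (k ≠ k₀ → t (k + j₀) + m * ((k₀ : ℝ) - k) < 0) →
      (0 < m → t (k + j₀) + m * ((k₀ : ℝ) - k) ≤ 0 → P) → P := fun P hP hQ => by
    have hle : t (k + j₀) + m * ((k₀ : ℝ) - k) ≤ 0 := by
      by_cases e : k = k₀
      · rw [e, h1]; simp
      · exact (hP e).le
    exact hQ (by by_contra hneg; push Not at hneg; nlinarith) hle
  constructor
  · intro h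
    refine key _ (fun e => ?_) fun hm0 hle i hi e1 e2 => ?_
    · have := h (k₀ + j₀) (by simp; omega) (by omega) (by omega)
      rw [h1] at this; push_cast at this; simpa using this
    rw [r2 k hk]
    rw [mem_Iic] at hi
    by_cases hik : k₀ ≤ i
    · rw [r2 i hik]
      have := h (i + j₀) (by simp; omega) (by omega) (by omega)
      push_cast at this; simpa using this
    · rw [r1 i (by omega)]
      have := hpos i (by omega) (by omega) (by omega)
      have : (i : ℝ) < k₀ := by exact_mod_cast (by omega : i < k₀)
      nlinarith
  · intro h
    refine key _ (fun e => ?_) fun hm0 hle i hi e1 e2 => ?_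
    · have := h k₀ (by simp; omega) (by omega) (by omega)
      rwa [r2 k hk, r1 k₀ le_rfl, h0] at this
    rw [mem_Iic] at hi
    push_cast
    by_cases hik : k₀ + j₀ ≤ i
    · obtain ⟨l, rfl⟩ : ∃ l, i = l + j₀ := ⟨i - j₀, by omega⟩
      have := h l (by simp; omega) (by omega) (by omega)
      rw [r2 k hk, r2 l (by omega)] at this
      push_cast; simpa using this
    have hiR : (i : ℝ) < k₀ + j₀ := by exact_mod_cast (by omega : i < k₀ + j₀)
    have := hnn i hi
    nlinarith

end Level

/-- Removing a strict face of `[0, n]` leaves the other faces. -/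
lemma prod_finiteFaces {M : Type*} [CommMonoid M] (h : ℕ → ℝ → M) {s : ℕ → ℝ} {n k₀ j₀ : ℕ}
    (hf : (k₀, j₀) ∈ finiteFaces n s) :
    ∏ p ∈ finiteFaces n s, h p.2 (s (p.1 + p.2) - s p.1) =
      h j₀ (s (k₀ + j₀) - s k₀) * ∏ p ∈ finiteFaces (n - j₀) (removeBlock s k₀ j₀),
        h p.2 (removeBlock s k₀ j₀ (p.1 + p.2) - removeBlock s k₀ j₀ p.1) := by
  classical
  obtain ⟨hj₀, hn, hface⟩ := mem_finiteFaces.1 hf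
  simp only at hj₀ hn hface
  set b := (s (k₀ + j₀) - s k₀) / j₀ with hb
  have hslope := slope_spec s k₀ hj₀
  rw [← hb] at hslope
  set a := s k₀ - b * k₀ with ha
  -- Subtracting the line through the removed face puts that face at level 0. The removed increment
  -- is `b * j₀`, so removal commutes with this tilt.
  set t : ℕ → ℝ := fun i => s i - (a + b * i) with ht
  have h0 : t k₀ = 0 := by simp [ht, ha]
  have h1 : t (k₀ + j₀) = 0 := by simp only [ht, hslope, ha]; push_cast; ring
  have hpos : ∀ i ≤ n, i ≠ k₀ → i ≠ k₀ + j₀ → 0 < t i := fun i hi e1 e2 => by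
    have := (isStrictFace_iff hj₀ hslope).1 hface i hi e1 e2
    simp only [ht, ha]; linarith
  have hrem : removeBlock t k₀ j₀ = fun i => removeBlock s k₀ j₀ i - (a + b * i) := by
    funext i
    simp only [removeBlock]
    split_ifs
    · rfl
    · rw [h0, h1]; simp only [ht]; rw [hslope]; push_cast; ring
  have hF : ∀ k j, 0 < j → (IsStrictFace (Iic n) s k j ↔ IsStrictFace (Iic n) t k j) :=
    fun k j hj => (isStrictFace_tilt hj a b).symm
  have hF' : ∀ k j, 0 < j → (IsStrictFace (Iic (n - j₀)) (removeBlock s k₀ j₀) k j ↔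
      IsStrictFace (Iic (n - j₀)) (removeBlock t k₀ j₀) k j) := fun k j hj => by
    rw [hrem]; exact (isStrictFace_tilt hj a b).symm
  rw [← Finset.mul_prod_erase _ _ hf]
  congr 1
  symm
  -- Faces of the shortened sequence before `k₀` stay in place; the others move right by `j₀`.
  refine Finset.prod_bij (fun p _ => if p.1 < k₀ then p else (p.1 + j₀, p.2)) ?_ ?_ ?_ ?_
  · rintro ⟨k, j⟩ hp
    rw [mem_finiteFaces] at hp
    obtain ⟨hj, hkn, hp⟩ := hp
    simp only at hj hkn hp ⊢
    rw [hF' k j hj] at hp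
    rw [Finset.mem_erase, mem_finiteFaces]
    rcases strictFace_removeBlock_disjoint_of_level hn h0 h1 hpos hj hkn hp with hk | hk
    · rw [if_pos (by omega)]
      refine ⟨fun e => ?_, hj, by simp only; omega, ?_⟩
      · simp only [Prod.mk.injEq] at e; omega
      rw [hF k j hj]
      exact (strictFace_left_iff_of_level hj₀ hn h0 h1 hpos hj hk).2 hp
    · rw [if_neg (by omega)]
      refine ⟨fun e => ?_, hj, by simp only; omega, ?_⟩
      · simp only [Prod.mk.injEq] at e; omega
      rw [hF (k + j₀) j hj]
      exact (strictFace_right_iff_of_level hj₀ hn h0 h1 hpos hj hk hkn).2 hp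
  · rintro ⟨k, j⟩ _ ⟨k', j'⟩ _ e
    simp only at e
    split_ifs at e <;> simp only [Prod.mk.injEq] at e ⊢ <;> omega
  · rintro ⟨k, j⟩ hp
    rw [Finset.mem_erase, mem_finiteFaces] at hp
    obtain ⟨hne, hj, hkn, hp⟩ := hp
    simp only [ne_eq, Prod.mk.injEq] at hne hj hkn hp
    rw [hF k j hj] at hp
    rcases strictFace_disjoint_of_level hj₀ hn h0 h1 hpos hj hkn hp with hk | hk | hk
    · exact absurd hk hne
    · refine ⟨(k, j), mem_finiteFaces.2 ⟨hj, by simp only; omega, ?_⟩, ?_⟩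
      · rw [hF' k j hj]
        exact (strictFace_left_iff_of_level hj₀ hn h0 h1 hpos hj hk).1 hp
      · rw [if_pos (by simp only; omega)]
    · obtain ⟨l, rfl⟩ : ∃ l, k = l + j₀ := ⟨k - j₀, by omega⟩
      refine ⟨(l, j), mem_finiteFaces.2 ⟨hj, by simp only; omega, ?_⟩, ?_⟩
      · rw [hF' l j hj]
        exact (strictFace_right_iff_of_level hj₀ hn h0 h1 hpos hj (by omega) (by omega)).1 hp
      · rw [if_neg (by simp only; omega)]
  · rintro ⟨k, j⟩ hp
    rw [mem_finiteFaces] at hp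
    obtain ⟨hj, hkn, hp⟩ := hp
    simp only at hj hkn hp ⊢
    rw [hF' k j hj] at hp
    rcases strictFace_removeBlock_disjoint_of_level hn h0 h1 hpos hj hkn hp with hk | hk
    · rw [if_pos (by omega)]
      simp only [removeBlock]
      rw [if_pos (by omega), if_pos (by omega)]
    · rw [if_neg (by omega)]
      simp only [removeBlock]
      rw [if_neg (by omega : ¬ k + j ≤ k₀), show k + j + j₀ = k + j₀ + j by omega]
      split_ifs with e
      · have : k = k₀ := by omega
        subst this; congr 1; ring
      · congr 1; ring

/-! ### Independent identically distributed sequences -/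

/-- The law of a sequence of independent variables with law `ν`. -/
noncomputable abbrev iidLaw (ν : Measure ℝ) : Measure (ℕ → ℝ) :=
  Measure.infinitePi fun _ => ν

/-- The partial sums of a sequence. -/
def psum (x : ℕ → ℝ) (n : ℕ) : ℝ := ∑ i ∈ Finset.range n, x i

@[fun_prop]
lemma measurable_psum (n : ℕ) : Measurable fun x => psum x n := by
  unfold psum; fun_prop

lemma psum_zero (x : ℕ → ℝ) : psum x 0 = 0 := by simp [psum]

lemma psum_succ (x : ℕ → ℝ) (n : ℕ) : psum x (n + 1) = psum x n + x n :=
  Finset.sum_range_succ _ _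

lemma psum_shift (x : ℕ → ℝ) (k i : ℕ) :
    psum (fun l => x (k + l)) i = psum x (k + i) - psum x k := by
  simp [psum, Finset.sum_range_add]

lemma psum_congr {x y : ℕ → ℝ} {n : ℕ} (h : ∀ i < n, x i = y i) : psum x n = psum y n :=
  Finset.sum_congr rfl fun i hi => h i (Finset.mem_range.1 hi)

/-- Such a function does not change when the coordinates outside `U` are set to 0, and this
substitution is measurable for the coordinates in `U`. -/
lemma comap_le_iSup_of_dependsOn {δ : Type*} [MeasurableSpace δ] {U : Set ℕ}
    {F : (ℕ → ℝ) → δ} (hF : Measurable F) (hU : DependsOn F U) :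
    MeasurableSpace.comap F inferInstance ≤
      ⨆ i ∈ U, MeasurableSpace.comap (fun x : ℕ → ℝ => x i) inferInstance := by
  classical
  have hF' : F = F ∘ fun x i => if i ∈ U then x i else 0 :=
    funext fun x => hU fun i hi => by simp [hi]
  rw [hF', ← measurable_iff_comap_le]
  refine hF.comp ?_
  refine @measurable_pi_lambda _ _ _ (_) _ _ fun i => ?_
  by_cases hi : i ∈ U
  · simp only [hi, if_true]
    rw [measurable_iff_comap_le]
    exact le_iSup₂_of_le i hi le_rfl
  · simp only [hi, if_false]
    exact measurable_const

section IID

variable (ν : Measure ℝ) [IsProbabilityMeasure ν]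

/-- This invariance serves for shifts, for moving a block to the front and for rotating a block. -/
lemma lintegral_iidLaw_comp {σ : ℕ → ℕ} (hσ : Function.Injective σ) {F : (ℕ → ℝ) → ℝ≥0∞}
    (hF : Measurable F) : ∫⁻ x, F (fun i => x (σ i)) ∂iidLaw ν = ∫⁻ x, F x ∂iidLaw ν := by
  have h := Measure.map_infinitePi_infinitePi_of_inj (P := fun _ : ℕ => ν) hσ
  conv_rhs => rw [iidLaw, ← h]
  rw [lintegral_map hF (by fun_prop)]

lemma ae_iidLaw_comp {σ : ℕ → ℕ} (hσ : Function.Injective σ) {p : (ℕ → ℝ) → Prop}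
    (hp : ∀ᵐ x ∂iidLaw ν, p x) : ∀ᵐ x ∂iidLaw ν, p (fun i => x (σ i)) := by
  have h := Measure.map_infinitePi_infinitePi_of_inj (P := fun _ : ℕ => ν) hσ
  rw [iidLaw, ← h] at hp
  exact ae_of_ae_map (Measurable.aemeasurable (by fun_prop)) hp

variable {ν}

lemma indepFun_iidLaw_of_dependsOn {β γ : Type*} [MeasurableSpace β] [MeasurableSpace γ]
    {S T : Set ℕ} (hST : Disjoint S T)
    {f : (ℕ → ℝ) → β} {h : (ℕ → ℝ) → γ} (hf : Measurable f) (hh : Measurable h)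
    (hfS : DependsOn f S) (hhT : DependsOn h T) : IndepFun f h (iidLaw ν) := by
  have h0 : iIndepFun (fun (i : ℕ) (x : ℕ → ℝ) => x i) (iidLaw ν) :=
    iIndepFun_infinitePi (X := fun _ ω => ω) (fun _ => measurable_id)
  have h1 := indep_iSup_of_disjoint (fun i => (measurable_pi_apply i).comap_le) h0.iIndep hST
  rw [IndepFun_iff_Indep]
  exact indep_of_indep_of_le_left
    (indep_of_indep_of_le_right h1 (comap_le_iSup_of_dependsOn hh hhT))
    (comap_le_iSup_of_dependsOn hf hfS)

lemma lintegral_iidLaw_mul_of_dependsOn {S T : Set ℕ} (hST : Disjoint S T)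
    {f h : (ℕ → ℝ) → ℝ≥0∞} (hf : Measurable f) (hh : Measurable h)
    (hfS : DependsOn f S) (hhT : DependsOn h T) :
    ∫⁻ x, f x * h x ∂iidLaw ν = (∫⁻ x, f x ∂iidLaw ν) * ∫⁻ x, h x ∂iidLaw ν :=
  lintegral_mul_eq_lintegral_mul_lintegral_of_indepFun hf hh
    (indepFun_iidLaw_of_dependsOn hST hf hh hfS hhT)

lemma lintegral_iidLaw_mul_shift {n : ℕ} {f h : (ℕ → ℝ) → ℝ≥0∞} (hf : Measurable f)
    (hh : Measurable h) (hfS : DependsOn f (Iio n)) :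
    ∫⁻ x, f x * h (fun i => x (n + i)) ∂iidLaw ν =
      (∫⁻ x, f x ∂iidLaw ν) * ∫⁻ x, h x ∂iidLaw ν := by
  rw [← lintegral_iidLaw_comp ν (add_right_injective n) hh]
  refine lintegral_iidLaw_mul_of_dependsOn (S := Iio n) (T := Ici n)
    (Set.disjoint_left.2 fun i hi hi' => by simp at hi hi'; omega) hf
    (hh.comp (by fun_prop)) hfS fun x y hxy => ?_
  congr 1
  funext i
  exact hxy (n + i) (by simp)

/-- The coordinate `x u` is independent of `h x` and has no atoms, so by Fubini the diagonal is
null. -/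
lemma ae_ne_of_dependsOn [NullSingletonClass ν] {u : ℕ} {h : (ℕ → ℝ) → ℝ} (hh : Measurable h)
    (hu : DependsOn h {u}ᶜ) : ∀ᵐ x ∂iidLaw ν, x u ≠ h x := by
  have hi : IndepFun (fun x : ℕ → ℝ => x u) h (iidLaw ν) :=
    indepFun_iidLaw_of_dependsOn (S := {u}) disjoint_compl_right (measurable_pi_apply u) hh
      (fun x y hxy => hxy u rfl) hu
  have h2 := (indepFun_iff_map_prod_eq_prod_map_map (measurable_pi_apply u).aemeasurable
    hh.aemeasurable).1 hi
  rw [Measure.infinitePi_map_eval (fun _ : ℕ => ν) u] at h2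
  have hD : MeasurableSet {p : ℝ × ℝ | p.1 = p.2} :=
    measurableSet_eq_fun measurable_fst measurable_snd
  have h3 : (ν.prod ((iidLaw ν).map h)) {p : ℝ × ℝ | p.1 = p.2} = 0 := by
    have : SFinite ((iidLaw ν).map h) := inferInstance
    rw [Measure.prod_apply_symm hD]
    simp only [preimage_ofPred_eq, ofPred_eq_eq_singleton, measure_singleton, lintegral_zero]
  rw [← h2, Measure.map_apply ((measurable_pi_apply u).prodMk hh) hD] at h3
  rw [ae_iff]
  simpa using h3

end IID

/-! ### Generic sequences -/

/-- The slopes over distinct intervals are distinct. -/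
def IsGeneric (s : ℕ → ℝ) : Prop :=
  ∀ p q p' q' : ℕ, p < q → p' < q' →
    ((q : ℝ) - p) * (s q' - s p') = ((q' : ℝ) - p') * (s q - s p) → p = p' ∧ q = q'

lemma psum_sub_psum (x : ℕ → ℝ) {p q : ℕ} (h : p ≤ q) :
    psum x q - psum x p = ∑ i ∈ Finset.Ico p q, x i :=
  (Finset.sum_Ico_eq_sub _ h).symm

/-- The index `u` enters only one of the two increments, so equality of slopes would express `x u`
through the other coordinates. -/
lemma ae_slope_ne {ν : Measure ℝ} [IsProbabilityMeasure ν] [NullSingletonClass ν] {p q p' q' u : ℕ}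
    (hp' : p' < q') (hu : u ∈ Finset.Ico p q) (hu' : u ∉ Finset.Ico p' q') :
    ∀ᵐ x ∂iidLaw ν, ((q : ℝ) - p) * (psum x q' - psum x p') ≠
      ((q' : ℝ) - p') * (psum x q - psum x p) := by
  have hpq : p < q := by simp at hu; omega
  have h := ae_ne_of_dependsOn (ν := ν) (u := u)
    (h := fun x => ((q : ℝ) - p) / ((q' : ℝ) - p') * ∑ i ∈ Finset.Ico p' q', x i -
      ∑ i ∈ (Finset.Ico p q).erase u, x i) (by fun_prop) ?_
  · filter_upwards [h] with x hx e
    apply hx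
    rw [psum_sub_psum x hpq.le, psum_sub_psum x hp'.le, ← Finset.add_sum_erase _ _ hu] at e
    have : ((q' : ℝ) - p') ≠ 0 := by
      have : (p' : ℝ) < q' := by exact_mod_cast hp'
      linarith
    field_simp
    linarith
  · intro x y hxy
    simp only
    rw [Finset.sum_congr rfl fun i hi => hxy i fun (e : i = u) => hu' (e ▸ hi),
      Finset.sum_congr rfl fun i hi => hxy i fun (e : i = u) => (Finset.mem_erase.1 hi).1 e]

lemma ae_isGeneric (ν : Measure ℝ) [IsProbabilityMeasure ν] [NullSingletonClass ν] :
    ∀ᵐ x ∂iidLaw ν, IsGeneric (psum x) := by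
  unfold IsGeneric
  simp only [ae_all_iff]
  intro p q p' q' hp hp'
  by_cases h : p = p' ∧ q = q'
  · simp [h]
  -- Of two distinct intervals, one has an index that the other lacks.
  have : (∃ u, u ∈ Finset.Ico p q ∧ u ∉ Finset.Ico p' q') ∨
      ∃ u, u ∈ Finset.Ico p' q' ∧ u ∉ Finset.Ico p q := by
    rcases lt_trichotomy p p' with h1 | h1 | h1
    · exact .inl ⟨p, by simp; omega, by simp; omega⟩
    · rcases lt_trichotomy q q' with h2 | h2 | h2
      · exact .inr ⟨q, by simp; omega, by simp⟩
      · exact absurd ⟨h1, h2⟩ h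
      · exact .inl ⟨q', by simp; omega, by simp⟩
    · exact .inr ⟨p', by simp; omega, by simp; omega⟩
  rcases this with ⟨u, h1, h2⟩ | ⟨u, h1, h2⟩
  · filter_upwards [ae_slope_ne (ν := ν) hp' h1 h2] with x hx e using absurd e hx
  · filter_upwards [ae_slope_ne (ν := ν) hp h1 h2] with x hx e using absurd e.symm hx

/-- An injective finite sequence attains its minimum once. -/
lemma sum_ite_argmin_eq_one {t : ℕ → ℝ} {N : ℕ} (hN : 0 < N)
    (ht : ∀ i < N, ∀ i' < N, t i = t i' → i = i') [∀ r, Decidable (∀ i < N, i ≠ r → t r < t i)] :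
    ∑ r ∈ Finset.range N, (if ∀ i < N, i ≠ r → t r < t i then (1 : ℝ≥0∞) else 0) = 1 := by
  obtain ⟨r, hr, hmin⟩ := (Finset.range N).exists_min_image t ⟨0, by simpa using hN⟩
  rw [Finset.mem_range] at hr
  have hr' : ∀ i < N, i ≠ r → t r < t i := fun i hi e =>
    (hmin i (by simpa using hi)).lt_of_ne fun h => e (ht r hr i hi h).symm
  rw [Finset.sum_eq_single r]
  · rw [if_pos hr']
  · intro b hb hbr
    rw [if_neg]
    intro h
    exact lt_asymm (h r hr hbr.symm) (hr' b (by simpa using hb) hbr)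
  · intro h; exact absurd (Finset.mem_range.2 hr) h

/-! ### The recursion for the faces of a finite walk -/

lemma removeBlock_last {s : ℕ → ℝ} {n k : ℕ} (i : ℕ) (hi : i ≤ k) :
    removeBlock s k (n - k) i = s i := by
  simp [removeBlock, hi]

lemma IsStrictFace.congr {D : Set ℕ} {s s' : ℕ → ℝ} {k j : ℕ} (h : ∀ i ∈ D, s i = s' i)
    (hk : k ∈ D) (hkj : k + j ∈ D) : IsStrictFace D s k j ↔ IsStrictFace D s' k j := by
  refine forall₄_congr fun i hi _ _ => ?_
  rw [h i hi, h k hk, h _ hkj]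

lemma finiteFaces_congr {s s' : ℕ → ℝ} {n : ℕ} (h : ∀ i ≤ n, s i = s' i) :
    finiteFaces n s = finiteFaces n s' := by
  ext ⟨k, j⟩
  rw [mem_finiteFaces, mem_finiteFaces]
  refine and_congr_right fun hj => and_congr_right fun hkj => ?_
  simp only at hkj
  exact IsStrictFace.congr (fun i hi => h i hi) (by simp; omega) (by simpa using hkj)

/-- The last face is the chord of greatest slope ending at `n`; genericity makes the maximum strict.
-/
lemma exists_last_face {s : ℕ → ℝ} (hs : IsGeneric s) {n : ℕ} (hn : 0 < n) :
    ∃ k < n, (k, n - k) ∈ finiteFaces n s := by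
  obtain ⟨k, hk, hmax⟩ := (Finset.range n).exists_max_image
    (fun k => (s n - s k) / ((n : ℝ) - k)) ⟨0, by simpa using hn⟩
  rw [Finset.mem_range] at hk
  refine ⟨k, hk, mem_finiteFaces.2 ⟨by simp only; omega, by simp only; omega, ?_⟩⟩
  have e : k + (n - k) = n := by omega
  intro i hi h1 h2
  simp only [e] at h2 ⊢
  rw [mem_Iic] at hi
  have hin : i < n := by omega
  have hkR : (0 : ℝ) < (n : ℝ) - k := by
    have : (k : ℝ) < n := by exact_mod_cast hk
    linarith
  have hiR : (0 : ℝ) < (n : ℝ) - i := by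
    have : (i : ℝ) < n := by exact_mod_cast hin
    linarith
  have h3 : (s n - s i) / ((n : ℝ) - i) < (s n - s k) / ((n : ℝ) - k) := by
    refine (hmax i (by simpa using hin)).lt_of_ne fun h => h1 ?_
    rw [div_eq_div_iff hiR.ne' hkR.ne'] at h
    exact (hs i n k n hin hk (by linear_combination -h)).1
  rw [Nat.cast_sub hk.le]
  set m := (s n - s k) / ((n : ℝ) - k) with hm
  have h4 : s n - s k = m * (n - k) := by rw [hm]; field_simp
  rw [div_lt_iff₀ hiR] at h3
  nlinarith

/-- The lengths of the strict faces of a generic sequence on `[0, n]` add up to `n`. -/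
lemma sum_finiteFaces {s : ℕ → ℝ} (hs : IsGeneric s) (n : ℕ) :
    ∑ p ∈ finiteFaces n s, p.2 = n := by
  induction n using Nat.strong_induction_on with
  | _ n ih =>
    rcases Nat.eq_zero_or_pos n with rfl | hn
    · refine Finset.sum_eq_zero fun p hp => ?_
      obtain ⟨h1, h2, -⟩ := mem_finiteFaces.1 hp
      omega
    obtain ⟨k, hk, hf⟩ := exists_last_face hs hn
    -- The weight `2 ^ j` turns the product formula into additivity of lengths. Removing the last
    -- face leaves the walk on `[0, k]`.
    have h := prod_finiteFaces (fun j _ => 2 ^ j) hf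
    simp only [Finset.prod_pow_eq_pow_sum] at h
    rw [← pow_add, show n - (n - k) = k by omega,
      finiteFaces_congr (fun i hi => removeBlock_last i hi), ih k hk] at h
    have := Nat.pow_right_injective le_rfl h
    omega

/-- The product over the strict faces of `s` on `[0, n]` of a function of length and increment. -/
noncomputable def faceProd (g : ℕ → ℝ → ℝ≥0∞) (n : ℕ) (s : ℕ → ℝ) : ℝ≥0∞ :=
  ∏ p ∈ finiteFaces n s, g p.2 (s (p.1 + p.2) - s p.1)

lemma faceProd_congr {g : ℕ → ℝ → ℝ≥0∞} {s s' : ℕ → ℝ} {n : ℕ} (h : ∀ i ≤ n, s i = s' i) :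
    faceProd g n s = faceProd g n s' := by
  unfold faceProd
  rw [finiteFaces_congr h]
  refine Finset.prod_congr rfl fun p hp => ?_
  obtain ⟨h1, h2, -⟩ := mem_finiteFaces.1 hp
  rw [h _ h2, h _ (by omega)]

lemma measurableSet_isStrictFace (D : Set ℕ) (k j : ℕ) :
    MeasurableSet {x : ℕ → ℝ | IsStrictFace D (psum x) k j} := by
  unfold IsStrictFace
  simp only [ofPred_forall]
  refine .iInter fun i => .iInter fun _ => .iInter fun _ => .iInter fun _ => ?_
  exact measurableSet_lt (by fun_prop) (by fun_prop)

lemma measurable_faceProd {g : ℕ → ℝ → ℝ≥0∞} (hg : ∀ j, Measurable (g j)) (n : ℕ) :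
    Measurable fun x => faceProd g n (psum x) := by
  classical
  unfold faceProd finiteFaces
  simp only [Finset.prod_filter]
  refine Finset.measurable_prod _ fun p _ => Measurable.ite ?_ ?_ measurable_const
  · exact (MeasurableSet.const _).inter
      ((MeasurableSet.const _).inter (measurableSet_isStrictFace _ _ _))
  · exact (hg p.2).comp (by fun_prop)

/-! ### Excursions, minima and the rearrangements that relate them to faces. -/

/-- The sum of the first `j` terms of `y` is a strict excursion above its chord. -/
def IsExcursion (j : ℕ) (y : ℕ → ℝ) : Prop :=
  ∀ i, 0 < i → i < j → psum y j / j * i < psum y i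

/-- `k` is the only point in `[0, N]` at which the sum of `z` tilted by `m` is minimal. -/
def IsArgmin (N : ℕ) (m : ℝ) (z : ℕ → ℝ) (k : ℕ) : Prop :=
  ∀ i < N + 1, i ≠ k → psum z k - m * k < psum z i - m * i

/-- The reindexing that moves the block `[k, k + j)` to the front. -/
def blockFront (k j i : ℕ) : ℕ :=
  if i < j then k + i else if i < j + k then i - j else i

lemma blockFront_injective (k j : ℕ) : Function.Injective (blockFront k j) := by
  intro a b h
  unfold blockFront at h
  split_ifs at h <;> omega

/-- The rotation by `r` of the first `j` indices. -/
def rotate (j r i : ℕ) : ℕ :=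
  if i < j then (if i + r < j then i + r else i + r - j) else i

lemma rotate_injective {j r : ℕ} (hr : r < j) : Function.Injective (rotate j r) := by
  intro a b h
  unfold rotate at h
  split_ifs at h <;> omega

lemma psum_blockFront (x : ℕ → ℝ) (k j : ℕ) {i : ℕ} (hi : i ≤ j) :
    psum (fun l => x (blockFront k j l)) i = psum x (k + i) - psum x k := by
  rw [← psum_shift]
  exact psum_congr fun l hl => by simp [blockFront, show l < j by omega]

lemma psum_shift_blockFront (x : ℕ → ℝ) (k j i : ℕ) :
    psum (fun l => x (blockFront k j (j + l))) i = removeBlock (psum x) k j i := by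
  induction i with
  | zero => simp [psum_zero, removeBlock]
  | succ i ih =>
    rw [psum_succ, ih]
    unfold removeBlock blockFront
    rcases lt_trichotomy i k with h | h | h
    · rw [if_pos h.le, if_neg (by omega), if_pos (by omega), if_pos (by omega), psum_succ]
      simp
    · subst h
      rw [if_pos le_rfl, if_neg (by omega), if_neg (by omega), if_neg (by omega),
        show i + 1 + j = i + j + 1 by omega, psum_succ, add_comm j i]
      ring
    · rw [if_neg (by omega), if_neg (by omega), if_neg (by omega), if_neg (by omega),
        show i + 1 + j = i + j + 1 by omega, psum_succ, add_comm j i]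
      ring

lemma psum_rotate (x : ℕ → ℝ) {j r : ℕ} (hr : r < j) {i : ℕ} (hi : i ≤ j) :
    psum (fun l => x (rotate j r l)) i =
      if i + r ≤ j then psum x (i + r) - psum x r
      else psum x j - psum x r + psum x (i + r - j) := by
  induction i with
  | zero => simp [psum_zero, hr.le]
  | succ i ih =>
    rw [psum_succ, ih (by omega)]
    unfold rotate
    rw [if_pos (by omega : i < j)]
    rcases lt_trichotomy (i + r) j with h | h | h
    · rw [if_pos h.le, if_pos h, if_pos (by omega), show i + 1 + r = i + r + 1 by omega, psum_succ]
      ring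
    · rw [if_pos h.le, if_neg h.not_lt, if_neg (by omega), show i + 1 + r - j = 0 + 1 by omega,
        psum_succ, psum_zero, show i + r - j = 0 by omega, h]
      ring
    · rw [if_neg h.not_ge, if_neg h.not_gt, if_neg (by omega),
        show i + 1 + r - j = i + r - j + 1 by omega, psum_succ]
      ring

/-- A block is a strict face when it is an excursion above its chord, inserted at the minimum of
the remaining walk tilted by its slope. -/
lemma isStrictFace_iff_blockFront (x : ℕ → ℝ) {n k j : ℕ} (hj : 0 < j) (hkn : k + j ≤ n) :
    IsStrictFace (Iic n) (psum x) k j ↔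
      IsExcursion j (fun l => x (blockFront k j l)) ∧
      IsArgmin (n - j) (psum (fun l => x (blockFront k j l)) j / j)
        (fun l => x (blockFront k j (j + l))) k := by
  have hslope := slope_spec (psum x) k hj
  unfold IsExcursion IsArgmin
  simp only [psum_shift_blockFront, psum_blockFront x k j le_rfl]
  rw [isStrictFace_iff hj hslope]
  set m := (psum x (k + j) - psum x k) / j
  constructor
  · refine fun h => ⟨fun i h1 h2 => ?_, fun i h1 h2 => ?_⟩
    · rw [psum_blockFront x k j h2.le]
      have := h (k + i) (by simp; omega) (by omega) (by omega)
      push_cast at this; linarith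
    · simp only [removeBlock, le_refl, if_true]
      split_ifs with h3
      · have := h i (by simp; omega) h2 (by omega)
        linarith
      · have := h (i + j) (by simp; omega) (by omega) (by omega)
        push_cast at this; linarith
  · rintro ⟨hE, hA⟩ i hi h1 h2
    rw [mem_Iic] at hi
    simp only [removeBlock, le_refl, if_true] at hA
    rcases lt_or_ge i k with h3 | h3
    · have := hA i (by omega) h1
      rw [if_pos h3.le] at this
      linarith
    rcases lt_or_ge i (k + j) with h4 | h4
    · obtain ⟨l, rfl⟩ : ∃ l, i = k + l := ⟨i - k, by omega⟩
      have := hE l (by omega) (by omega)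
      rw [psum_blockFront x k j (by omega)] at this
      push_cast; linarith
    · obtain ⟨l, rfl⟩ : ∃ l, i = l + j := ⟨i - j, by omega⟩
      have := hA l (by omega) (by omega)
      rw [if_neg (by omega)] at this
      push_cast; linarith

/-- The walk minus its chord vanishes at 0 and `j`, hence extends periodically. A rotation restarts
it at `r`, and it stays above its starting height exactly when that height is the strict minimum
over the period. -/
lemma isExcursion_rotate_iff (x : ℕ → ℝ) {j r : ℕ} (hr : r < j) :
    IsExcursion j (fun l => x (rotate j r l)) ↔
      ∀ i < j, i ≠ r → psum x r - psum x j / j * r < psum x i - psum x j / j * i := by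
  unfold IsExcursion
  have hj : psum (fun l => x (rotate j r l)) j = psum x j := by
    rw [psum_rotate x hr le_rfl]
    split_ifs with h
    · have : r = 0 := by omega
      subst this; simp [psum_zero]
    · rw [Nat.add_sub_cancel_left]; ring
  have hjR : (0 : ℝ) < j := by exact_mod_cast (by omega : 0 < j)
  have hc : psum x j = psum x j / j * j := by field_simp
  rw [hj]
  set m := psum x j / j
  constructor
  · intro h i hi hir
    rcases lt_or_ge i r with h1 | h1
    · have := h (i + j - r) (by omega) (by omega)
      rw [psum_rotate x hr (by omega)] at this
      rw [Nat.cast_sub (by omega)] at this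
      push_cast at this
      split_ifs at this with h2
      · have e : i = 0 := by omega
        subst e
        rw [psum_zero, show 0 + j - r + r = j by omega] at *
        push_cast at *
        linarith
      · rw [show i + j - r + r - j = i by omega] at this
        linarith
    · have := h (i - r) (by omega) (by omega)
      rw [psum_rotate x hr (by omega), if_pos (by omega), show i - r + r = i by omega,
        Nat.cast_sub h1] at this
      linarith
  · intro h i hi hij
    rw [psum_rotate x hr hij.le]
    split_ifs with h1
    · rcases h1.eq_or_lt with h2 | h2
      · have := h 0 (by omega) (by omega)
        rw [psum_zero] at this
        rw [h2]
        have h3 : (i : ℝ) = j - r := by rw [← h2]; push_cast; ring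
        rw [h3, hc]
        push_cast at this
        linarith
      · have := h (i + r) h2 (by omega)
        push_cast at this
        linarith
    · have := h (i + r - j) (by omega) (by omega)
      rw [Nat.cast_sub (by omega)] at this
      push_cast at this
      linarith

lemma measurableSet_isExcursion (j : ℕ) : MeasurableSet {y : ℕ → ℝ | IsExcursion j y} := by
  unfold IsExcursion
  simp only [ofPred_forall]
  refine .iInter fun i => .iInter fun _ => .iInter fun _ => ?_
  exact measurableSet_lt (by fun_prop) (by fun_prop)

open Classical in
-- A tie would give an interval beyond `j` with the same slope as `[0, j)`, against genericity.
lemma sum_isArgmin {y : ℕ → ℝ} (hy : IsGeneric (psum y)) {j : ℕ} (hj : 0 < j) (N : ℕ) :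
    ∑ k ∈ Finset.range (N + 1),
      (if IsArgmin N (psum y j / j) (fun i => y (j + i)) k then (1 : ℝ≥0∞) else 0) = 1 := by
  refine Eq.trans ?_
    (sum_ite_argmin_eq_one (t := fun i => psum (fun i => y (j + i)) i - psum y j / j * i)
    (Nat.succ_pos N) fun i _ i' _ h => ?_)
  · exact Finset.sum_congr rfl fun k _ => if_congr Iff.rfl rfl rfl
  have hjR : (0 : ℝ) < j := by exact_mod_cast hj
  simp only [psum_shift] at h
  by_contra hne
  have h' : (j : ℝ) * (psum y (j + i') - psum y (j + i)) = ((i' : ℝ) - i) * psum y j := by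
    field_simp at h; linarith
  rcases lt_or_gt_of_ne hne with hlt | hlt
  · have := hy 0 j (j + i) (j + i') hj (by omega)
      (by push_cast; rw [psum_zero]; linear_combination h')
    omega
  · have := hy 0 j (j + i') (j + i) hj (by omega)
      (by push_cast; rw [psum_zero]; linear_combination -h')
    omega

open Classical in
-- This is the cycle lemma. A tie would give an interval inside `[0, j)`, different from it, with
-- the same slope.
lemma sum_isExcursion_rotate {x : ℕ → ℝ} (hx : IsGeneric (psum x)) {j : ℕ} (hj : 0 < j) :
    ∑ r ∈ Finset.range j,
      (if IsExcursion j (fun l => x (rotate j r l)) then (1 : ℝ≥0∞) else 0) = 1 := by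
  have hjR : (0 : ℝ) < j := by exact_mod_cast hj
  refine (Finset.sum_congr rfl fun r hr =>
    if_congr (isExcursion_rotate_iff x (Finset.mem_range.1 hr)) rfl rfl).trans
    (sum_ite_argmin_eq_one (t := fun i => psum x i - psum x j / j * i) hj ?_)
  · intro i hi i' hi' h
    have h' : (j : ℝ) * (psum x i' - psum x i) = ((i' : ℝ) - i) * psum x j := by
      field_simp at h; linarith
    by_contra hne
    rcases lt_or_gt_of_ne hne with hlt | hlt
    · have := hx 0 j i i' hj (by omega) (by push_cast; rw [psum_zero]; linear_combination h')
      omega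
    · have := hx 0 j i' i hj (by omega) (by push_cast; rw [psum_zero]; linear_combination -h')
      omega

lemma measurableSet_isArgmin (N j k : ℕ) :
    MeasurableSet {y : ℕ → ℝ | IsArgmin N (psum y j / j) (fun i => y (j + i)) k} := by
  unfold IsArgmin
  simp only [psum_shift, ofPred_forall]
  refine .iInter fun i => .iInter fun _ => .iInter fun _ => ?_
  exact measurableSet_lt (by fun_prop) (by fun_prop)

/-- The expected product over the strict faces of the walk on `[0, n]`. -/
noncomputable def meanFaceProd (ν : Measure ℝ) (g : ℕ → ℝ → ℝ≥0∞) (n : ℕ) : ℝ≥0∞ :=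
  ∫⁻ x, faceProd g n (psum x) ∂iidLaw ν

section Recursion

variable {ν : Measure ℝ} [IsProbabilityMeasure ν] {g : ℕ → ℝ → ℝ≥0∞}

open Classical in
-- The integrands correspond under `blockFront`: the factor of the chosen face splits off and the
-- remaining faces are those of the shifted walk. On the right, `k` appears only in the minimum
-- indicator, ready to be summed.
lemma lintegral_isStrictFace_faceProd (hg : ∀ j, Measurable (g j)) {n k j : ℕ} (hj : 0 < j)
    (hkn : k + j ≤ n) :
    ∫⁻ x, (if IsStrictFace (Iic n) (psum x) k j then faceProd g n (psum x) else 0) ∂iidLaw ν =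
      ∫⁻ y, (if IsArgmin (n - j) (psum y j / j) (fun i => y (j + i)) k then 1 else 0) *
        ((if IsExcursion j y then 1 else 0) *
          (g j (psum y j) * faceProd g (n - j) (psum fun i => y (j + i)))) ∂iidLaw ν := by
  refine Eq.trans ?_ (lintegral_iidLaw_comp ν (blockFront_injective k j) ?_)
  · refine lintegral_congr fun x => ?_
    by_cases h : IsStrictFace (Iic n) (psum x) k j
    · obtain ⟨h1, h2⟩ := (isStrictFace_iff_blockFront x hj hkn).1 h
      rw [if_pos h, if_pos h1, if_pos h2, one_mul, one_mul, faceProd,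
        prod_finiteFaces g (mem_finiteFaces.2 ⟨hj, hkn, h⟩), psum_blockFront x k j le_rfl]
      rw [show (psum fun l => x (blockFront k j (j + l))) = removeBlock (psum x) k j from
        funext fun i => psum_shift_blockFront x k j i]
      rfl
    · rw [if_neg h]
      rw [isStrictFace_iff_blockFront x hj hkn, not_and_or] at h
      rcases h with h | h <;> simp [h]
  · refine (Measurable.ite (measurableSet_isArgmin _ _ _) measurable_const measurable_const).mul
      ((Measurable.ite (measurableSet_isExcursion j) measurable_const measurable_const).mul
      (((hg j).comp (measurable_psum j)).mul ?_))
    exact (measurable_faceProd hg (n - j)).comp (by fun_prop : Measurable fun (y : ℕ → ℝ) i => y (j + i))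

lemma meanFaceProd_zero : meanFaceProd ν g 0 = 1 := by
  have : ∀ s, finiteFaces 0 s = ∅ := fun s => by
    ext p
    simp only [mem_finiteFaces, Finset.notMem_empty, iff_false]
    omega
  simp [meanFaceProd, faceProd, this]

variable [NullSingletonClass ν]

open Classical in
-- Rotating the first `j` steps changes neither their sum nor the later steps. So the factor `j` can
-- be spent on the `j` rotations, whose excursion indicators add up to 1; what remains factors by
-- independence.
lemma mul_lintegral_isExcursion (hg : ∀ j, Measurable (g j)) {n j : ℕ} (hj : 0 < j) :
    (j : ℝ≥0∞) * ∫⁻ y, (if IsExcursion j y then 1 else 0) *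
        (g j (psum y j) * faceProd g n (psum fun i => y (j + i))) ∂iidLaw ν =
      (∫⁻ x, g j (psum x j) ∂iidLaw ν) * meanFaceProd ν g n := by
  have hm1 : Measurable fun y : ℕ → ℝ => g j (psum y j) := (hg j).comp (measurable_psum j)
  have hm2 : Measurable fun y : ℕ → ℝ => faceProd g n (psum fun i => y (j + i)) :=
    (measurable_faceProd hg n).comp (by fun_prop : Measurable fun (y : ℕ → ℝ) i => y (j + i))
  have hm3 : Measurable fun y : ℕ → ℝ => (if IsExcursion j y then (1 : ℝ≥0∞) else 0) :=
    Measurable.ite (measurableSet_isExcursion j) measurable_const measurable_const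
  have h1 : ∀ r ∈ Finset.range j, ∫⁻ y, (if IsExcursion j y then 1 else 0) *
        (g j (psum y j) * faceProd g n (psum fun i => y (j + i))) ∂iidLaw ν =
      ∫⁻ x, (if IsExcursion j (fun l => x (rotate j r l)) then 1 else 0) *
        (g j (psum x j) * faceProd g n (psum fun i => x (j + i))) ∂iidLaw ν := by
    intro r hr
    rw [Finset.mem_range] at hr
    refine (lintegral_iidLaw_comp ν (rotate_injective hr) (hm3.mul (hm1.mul hm2))).symm.trans ?_
    refine lintegral_congr fun x => ?_
    have e1 : psum (fun l => x (rotate j r l)) j = psum x j := by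
      rw [psum_rotate x hr le_rfl]
      split_ifs with h
      · have : r = 0 := by omega
        subst this; simp [psum_zero]
      · rw [Nat.add_sub_cancel_left]; ring
    have e2 : ∀ i, rotate j r (j + i) = j + i := fun i => by simp [rotate]
    simp only [Pi.mul_apply, e1, e2]
  have h2 : (j : ℝ≥0∞) * ∫⁻ y, (if IsExcursion j y then 1 else 0) *
        (g j (psum y j) * faceProd g n (psum fun i => y (j + i))) ∂iidLaw ν =
      ∑ r ∈ Finset.range j, ∫⁻ x, (if IsExcursion j (fun l => x (rotate j r l)) then 1 else 0) *
        (g j (psum x j) * faceProd g n (psum fun i => x (j + i))) ∂iidLaw ν := by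
    rw [← Finset.sum_congr rfl h1, Finset.sum_const, Finset.card_range, nsmul_eq_mul]
  rw [h2, ← lintegral_finsetSum]
  · rw [meanFaceProd, ← lintegral_iidLaw_mul_shift (n := j) hm1 (measurable_faceProd hg n)]
    · refine lintegral_congr_ae ?_
      filter_upwards [ae_isGeneric ν] with x hx
      rw [← Finset.sum_mul, sum_isExcursion_rotate hx hj, one_mul]
    · intro x y hxy
      simp only
      rw [psum_congr fun i hi => hxy i hi]
  · intro r _
    exact (hm3.comp (by fun_prop : Measurable fun (x : ℕ → ℝ) l => x (rotate j r l))).mul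
      (hm1.mul hm2)

/-- The recursion for the expected products over faces. -/
lemma mul_meanFaceProd (hg : ∀ j, Measurable (g j)) (n : ℕ) :
    (n : ℝ≥0∞) * meanFaceProd ν g n =
      ∑ j ∈ Finset.Icc 1 n, (∫⁻ x, g j (psum x j) ∂iidLaw ν) * meanFaceProd ν g (n - j) := by
  classical
  have hmeas : ∀ j k, Measurable fun x : ℕ → ℝ =>
      if IsStrictFace (Iic n) (psum x) k j then faceProd g n (psum x) else 0 := fun j k =>
    Measurable.ite (measurableSet_isStrictFace _ _ _) (measurable_faceProd hg n) measurable_const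
  have hmeas3 : ∀ j, Measurable fun y : ℕ → ℝ => (if IsExcursion j y then (1 : ℝ≥0∞) else 0) :=
    fun j => Measurable.ite (measurableSet_isExcursion j) measurable_const measurable_const
  have h1 : (n : ℝ≥0∞) * meanFaceProd ν g n = ∫⁻ x, ∑ j ∈ Finset.Icc 1 n,
      ∑ k ∈ Finset.range (n - j + 1), (j : ℝ≥0∞) *
        (if IsStrictFace (Iic n) (psum x) k j then faceProd g n (psum x) else 0) ∂iidLaw ν := by
    rw [meanFaceProd, ← lintegral_const_mul _ (measurable_faceProd hg n)]
    refine lintegral_congr_ae ?_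
    filter_upwards [ae_isGeneric ν] with x hx
    -- The factor `n` becomes the total length of the faces, so each face is counted with weight its
    -- length.
    have hn : (n : ℝ≥0∞) = ∑ p ∈ finiteFaces n (psum x), (p.2 : ℝ≥0∞) := by
      rw [← Nat.cast_sum, sum_finiteFaces hx n]
    rw [hn, Finset.sum_mul, Finset.sum_sigma']
    simp only [mul_ite, mul_zero]
    rw [← Finset.sum_filter]
    refine Finset.sum_bij (fun p _ => ⟨p.2, p.1⟩) ?_ ?_ ?_ ?_
    · rintro ⟨k, j⟩ hp
      obtain ⟨a, b, c⟩ := mem_finiteFaces.1 hp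
      simp only [Finset.mem_filter, Finset.mem_sigma, Finset.mem_Icc, Finset.mem_range] at a b c ⊢
      exact ⟨by omega, c⟩
    · rintro ⟨k, j⟩ _ ⟨k', j'⟩ _ h
      simp only [Sigma.mk.injEq, heq_eq_eq] at h
      simp [h.1, h.2]
    · rintro ⟨j, k⟩ hp
      simp only [Finset.mem_filter, Finset.mem_sigma, Finset.mem_Icc, Finset.mem_range] at hp
      exact ⟨(k, j), mem_finiteFaces.2 ⟨by simp only; omega, by simp only; omega, hp.2⟩, rfl⟩
    · intro p _; rfl
  rw [h1, lintegral_finsetSum _ fun j _ => Finset.measurable_sum _ fun k _ =>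
    (hmeas j k).const_mul _]
  refine Finset.sum_congr rfl fun j hj => ?_
  rw [Finset.mem_Icc] at hj
  rw [← mul_lintegral_isExcursion hg hj.1, lintegral_finsetSum _ fun k _ => (hmeas j k).const_mul _]
  simp only [lintegral_const_mul _ (hmeas j _)]
  rw [← Finset.mul_sum]
  congr 1
  rw [Finset.sum_congr rfl fun k hk => lintegral_isStrictFace_faceProd hg hj.1
    (by rw [Finset.mem_range] at hk; omega), ← lintegral_finsetSum]
  -- Summed over the positions `k` of insertion, the minimum indicators give 1.
  · refine lintegral_congr_ae ?_
    filter_upwards [ae_isGeneric ν] with y hy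
    rw [← Finset.sum_mul, sum_isArgmin hy hj.1, one_mul]
  · intro k _
    refine (Measurable.ite (measurableSet_isArgmin _ _ _) measurable_const measurable_const).mul
      ((hmeas3 j).mul (((hg j).comp (measurable_psum j)).mul ?_))
    exact (measurable_faceProd hg (n - j)).comp
      (by fun_prop : Measurable fun (y : ℕ → ℝ) i => y (j + i))

end Recursion

/-! ### Solving the recursion -/

lemma hasDerivAt_tsum_mul_pow_succ {b : ℕ → ℝ} (hb : ∀ k, |b k| ≤ 1) {q : ℝ} (hq : |q| < 1) :
    HasDerivAt (fun q => ∑' k, b k * q ^ (k + 1)) (∑' k : ℕ, ((k : ℝ) + 1) * b k * q ^ k) q := by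
  obtain ⟨r, hr, hr1⟩ := exists_between hq
  have hr0 : 0 < r := (abs_nonneg q).trans_lt hr
  have hu : Summable fun k : ℕ => ((k : ℝ) + 1) * r ^ k := by
    have h1 := summable_pow_mul_geometric_of_norm_lt_one 1 (r := r)
      (by rwa [Real.norm_of_nonneg hr0.le])
    have h2 := summable_geometric_of_lt_one hr0.le hr1
    refine (h1.add h2).congr fun k => ?_
    simp; ring
  refine hasDerivAt_tsum_of_isPreconnected (t := Ioo (-r) r) (y₀ := 0) hu isOpen_Ioo
    isPreconnected_Ioo (g := fun k y => b k * y ^ (k + 1))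
    (g' := fun (k : ℕ) y => ((k : ℝ) + 1) * b k * y ^ k) (fun k y _ => ?_)
    (fun k y hy => ?_) (by simp [hr0]) (by simp) (by rwa [mem_Ioo, ← abs_lt])
  · have := (hasDerivAt_pow (k + 1) y).const_mul (b k)
    refine this.congr_deriv ?_
    push_cast
    ring
  · rw [Real.norm_eq_abs, abs_mul, abs_mul, abs_pow, abs_of_nonneg (by positivity : (0 : ℝ) ≤ k + 1)]
    have hy' : |y| ≤ r := (abs_lt.2 hy).le
    have := pow_le_pow_left₀ (abs_nonneg y) hy' k
    calc ((k : ℝ) + 1) * |b k| * |y| ^ k ≤ (k + 1) * 1 * r ^ k := by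
          gcongr
          exact hb k
      _ = _ := by ring

lemma summable_mul_pow_succ {b : ℕ → ℝ} (hb : ∀ k, |b k| ≤ 1) {q : ℝ} (hq : |q| < 1) :
    Summable fun k => b k * q ^ (k + 1) := by
  refine Summable.of_norm_bounded (g := fun k => |q| ^ k)
    (summable_geometric_of_lt_one (abs_nonneg q) hq) fun k => ?_
  rw [Real.norm_eq_abs, abs_mul, abs_pow]
  calc |b k| * |q| ^ (k + 1) ≤ 1 * |q| ^ (k + 1) := by gcongr; exact hb k
    _ ≤ |q| ^ k := by rw [one_mul]; exact pow_le_pow_of_le_one (abs_nonneg q) hq.le (by omega)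

lemma continuousOn_tsum_mul_pow_succ {b : ℕ → ℝ} (hb : ∀ k, 0 ≤ b k) (hs : Summable b) :
    ContinuousOn (fun q : ℝ => ∑' k, b k * q ^ (k + 1)) (Icc 0 1) := by
  refine continuousOn_tsum (fun k => by fun_prop) hs fun k q hq => ?_
  rw [Real.norm_of_nonneg (mul_nonneg (hb k) (pow_nonneg hq.1 _))]
  exact mul_le_of_le_one_right (hb k) (pow_le_one₀ hq.1 hq.2)

/-- A sequence satisfying the recursion of the coefficients of an exponential sums to the
exponential. -/
lemma one_add_tsum_eq_exp {φ γ : ℕ → ℝ} (hφ0 : φ 0 = 1) (hφ : ∀ n, 0 ≤ φ n) (hφ1 : ∀ n, φ n ≤ 1)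
    (hγ : ∀ n, 0 ≤ γ n) (hγ1 : ∀ n, γ n ≤ 1)
    (hrec : ∀ n : ℕ, ((n : ℝ) + 1) * φ (n + 1) = ∑ k ∈ Finset.range (n + 1), γ k * φ (n - k))
    (hs : Summable φ) :
    (Summable fun k : ℕ => γ k / (k + 1)) ∧
      ∑' n, φ n = Real.exp (∑' k : ℕ, γ k / (k + 1)) := by
  set b : ℕ → ℝ := fun k => γ k / (k + 1) with hbdef
  have hb0 : ∀ k, 0 ≤ b k := fun k => div_nonneg (hγ k) (by positivity)
  have hb1 : ∀ k, |b k| ≤ 1 := fun k => by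
    rw [abs_of_nonneg (hb0 k)]
    refine div_le_one_of_le₀ ((hγ1 k).trans ?_) (by positivity)
    linarith [(Nat.cast_nonneg k : (0 : ℝ) ≤ k)]
  have hc1 : ∀ k, |φ (k + 1)| ≤ 1 := fun k => by rw [abs_of_nonneg (hφ _)]; exact hφ1 _
  set F : ℝ → ℝ := fun q => 1 + ∑' k, φ (k + 1) * q ^ (k + 1) with hF
  set G : ℝ → ℝ := fun q => ∑' k, b k * q ^ (k + 1) with hG
  -- By the recursion, the derivative of `F` is the Cauchy product of `∑ γ k q ^ k` and `F`, so `F`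
  -- and `exp G` solve the same linear equation.
  have hFder : ∀ q, |q| < 1 → HasDerivAt F
      ((∑' k : ℕ, γ k * q ^ k) * F q) q := fun q hq => by
    have h1 := (hasDerivAt_tsum_mul_pow_succ hc1 hq).const_add 1
    refine h1.congr_deriv ?_
    have e1 : F q = ∑' k, φ k * q ^ k := by
      have hsum : Summable fun k => φ k * q ^ k := by
        rw [← summable_nat_add_iff 1]; exact summable_mul_pow_succ hc1 hq
      rw [hsum.tsum_eq_zero_add]
      simp [hF, hφ0]
    have habs : ∀ {a : ℕ → ℝ}, (∀ n, 0 ≤ a n) → (∀ n, a n ≤ 1) →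
        Summable fun k => ‖a k * q ^ k‖ := fun {a} h0 h1 =>
      Summable.of_nonneg_of_le (fun _ => norm_nonneg _) (fun k => by
        rw [norm_mul, norm_pow, Real.norm_of_nonneg (h0 k), Real.norm_eq_abs]
        exact mul_le_of_le_one_left (by positivity) (h1 k))
        (summable_geometric_of_lt_one (abs_nonneg q) hq)
    symm
    rw [e1, tsum_mul_tsum_eq_tsum_sum_range_of_summable_norm (habs hγ hγ1) (habs hφ hφ1)]
    refine tsum_congr fun n => ?_
    rw [hrec, Finset.sum_mul]
    refine Finset.sum_congr rfl fun k hk => ?_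
    have : q ^ n = q ^ k * q ^ (n - k) := by
      rw [← pow_add]; congr 1; rw [Finset.mem_range] at hk; omega
    rw [this]; ring
  have hGder : ∀ q, |q| < 1 → HasDerivAt G (∑' k : ℕ, γ k * q ^ k) q := fun q hq => by
    have h1 := hasDerivAt_tsum_mul_pow_succ hb1 hq
    refine h1.congr_deriv (tsum_congr fun k => ?_)
    have : (k : ℝ) + 1 ≠ 0 := by positivity
    simp only [hbdef]; field_simp
  have hFG : ∀ q ∈ Ioo (-1 : ℝ) 1, F q = Real.exp (G q) := fun q hq => by
    have hd : ∀ y ∈ Ioo (-1 : ℝ) 1, HasDerivAt (fun y => F y * Real.exp (-G y)) 0 y := fun y hy => by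
      have hy' := abs_lt.2 hy
      have := (hFder y hy').mul ((hGder y hy').neg.exp)
      refine this.congr_deriv ?_
      ring
    have h0 : F q * Real.exp (-G q) = F 0 * Real.exp (-G 0) :=
      isOpen_Ioo.is_const_of_deriv_eq_zero isPreconnected_Ioo
        (fun y hy => (hd y hy).differentiableAt.differentiableWithinAt)
        (fun y hy => (hd y hy).deriv) hq (by simp)
    have hF0 : F 0 = 1 := by simp [hF]
    have hG0 : G 0 = 0 := by simp [hG]
    rw [hF0, hG0, Real.exp_neg, mul_inv_eq_iff_eq_mul₀ (Real.exp_ne_zero _)] at h0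
    simpa using h0
  have hs' : Summable fun k => φ (k + 1) := (summable_nat_add_iff 1).2 hs
  have hFtot : F 1 = ∑' n, φ n := by
    rw [hs.tsum_eq_zero_add, hφ0]; simp [hF]
  have hFle : ∀ q ∈ Ico (0 : ℝ) 1, F q ≤ F 1 := fun q hq => by
    have hsq := summable_mul_pow_succ hc1 (q := q) (by rw [abs_of_nonneg hq.1]; exact hq.2)
    refine add_le_add_right (hsq.tsum_le_tsum (fun k => ?_) (by simpa using hs')) 1
    rw [one_pow, mul_one]
    exact mul_le_of_le_one_right (hφ _) (pow_le_one₀ hq.1 hq.2.le)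
  have hF1 : 1 ≤ F 1 := by
    have := hFle 0 (by simp); simpa [hF] using this
  have hsb : Summable b := by
    -- For `q < 1`, the partial sums are at most `G q = log (F q) ≤ log (F 1)`. For a fixed number
    -- of terms the bound passes to `q = 1` by continuity.
    refine summable_of_sum_range_le (c := Real.log (F 1)) hb0 fun N => ?_
    have h1 : ∀ q ∈ Ico (0 : ℝ) 1, ∑ k ∈ Finset.range N, b k * q ^ (k + 1) ≤ Real.log (F 1) := by
      intro q hq
      have h2 : Real.exp (G q) ≤ F 1 := by
        rw [← hFG q ⟨by linarith [hq.1], hq.2⟩]; exact hFle q hq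
      have h3 : G q ≤ Real.log (F 1) := by
        rw [Real.le_log_iff_exp_le (by linarith)]; exact h2
      refine le_trans ?_ h3
      exact (summable_mul_pow_succ hb1 (by rw [abs_of_nonneg hq.1]; exact hq.2)).sum_le_tsum _
        fun k _ => mul_nonneg (hb0 k) (pow_nonneg hq.1 _)
    have hcont : Continuous fun q : ℝ => ∑ k ∈ Finset.range N, b k * q ^ (k + 1) := by fun_prop
    have h4 := (isClosed_Iic (a := Real.log (F 1))).preimage hcont
    have h5 : Icc (0 : ℝ) 1 ⊆ (fun q : ℝ => ∑ k ∈ Finset.range N, b k * q ^ (k + 1)) ⁻¹'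
        Iic (Real.log (F 1)) := by
      rw [← closure_Ico (zero_ne_one' ℝ)]
      exact h4.closure_subset_iff.2 h1
    simpa using h5 (right_mem_Icc.2 zero_le_one)
  refine ⟨hsb, ?_⟩
  have hcF : ContinuousOn F (Icc 0 1) :=
    continuousOn_const.add (continuousOn_tsum_mul_pow_succ (fun k => hφ (k + 1)) hs')
  have hcG : ContinuousOn G (Icc 0 1) := continuousOn_tsum_mul_pow_succ hb0 hsb
  have heq : EqOn F (fun q => Real.exp (G q)) (Icc 0 1) := by
    refine EqOn.of_subset_closure (s := Ico (0 : ℝ) 1) (fun q hq => hFG q ⟨by linarith [hq.1], hq.2⟩)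
      hcF hcG.rexp Ico_subset_Icc_self ?_
    rw [closure_Ico (zero_ne_one' ℝ)]
  rw [← hFtot, heq (right_mem_Icc.2 zero_le_one)]
  simp [hG]

/-! ### The faces of slope less than `a` -/

/-- `n` is the only index at which the tilted sequence `s i - a * i` is minimal. -/
def IsGlobalArgmin (a : ℝ) (s : ℕ → ℝ) (n : ℕ) : Prop :=
  ∀ i, i ≠ n → s n - a * n < s i - a * i

/-- The function `g`, set to zero at slopes that are at least `a`. -/
noncomputable def slopeCut (a : ℝ) (g : ℕ → ℝ → ℝ≥0∞) (j : ℕ) (x : ℝ) : ℝ≥0∞ :=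
  if x < a * j then g j x else 0

lemma measurable_slopeCut (a : ℝ) {g : ℕ → ℝ → ℝ≥0∞} (hg : ∀ j, Measurable (g j)) (j : ℕ) :
    Measurable (slopeCut a g j) :=
  Measurable.ite (measurableSet_lt measurable_id measurable_const) (hg j) measurable_const

open Classical in
-- Slopes of successive faces increase, so all are less than `a` exactly when the last one is, that
-- is, when the tilted walk on `[0, n]` has its strict minimum at `n`. Otherwise the last face
-- contributes a factor 0.
lemma faceProd_slopeCut (a : ℝ) (g : ℕ → ℝ → ℝ≥0∞) {s : ℕ → ℝ} (hs : IsGeneric s) (n : ℕ) :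
    faceProd (slopeCut a g) n s =
      if ∀ i < n, s n - a * n < s i - a * i then faceProd g n s else 0 := by
  split_ifs with h
  · refine Finset.prod_congr rfl fun p hp => ?_
    obtain ⟨hj, hkn, hf⟩ := mem_finiteFaces.1 hp
    rw [slopeCut, if_pos]
    have h1 := h p.1 (by omega)
    have hjR : (0 : ℝ) < p.2 := by exact_mod_cast hj
    rcases hkn.eq_or_lt with h2 | h2
    · rw [← h2] at h1
      push_cast at h1; rw [h2] at *; linarith
    · have hm := slope_spec s p.1 hj
      have h3 := (isStrictFace_iff hj hm).1 hf n (by simp) (by omega) (by omega)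
      set m := (s (p.1 + p.2) - s p.1) / p.2
      have h4 : (p.1 : ℝ) < n := by exact_mod_cast (by omega : p.1 < n)
      have h5 : m < a := by
        by_contra hc; push Not at hc; nlinarith
      rw [hm]; nlinarith
  · push Not at h
    obtain ⟨i, hi, hle⟩ := h
    obtain ⟨k, hk, hf⟩ := exists_last_face hs (by omega : 0 < n)
    refine Finset.prod_eq_zero hf ?_
    simp only [slopeCut]
    rw [if_neg]
    obtain ⟨hj, hkn, hf⟩ := mem_finiteFaces.1 hf
    simp only at hj hkn hf
    have hm := slope_spec s k hj
    rw [isStrictFace_iff hj hm] at hf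
    set m := (s (k + (n - k)) - s k) / (n - k : ℕ)
    have e : k + (n - k) = n := by omega
    have hkR : (k : ℝ) < n := by exact_mod_cast hk
    have hiR : (i : ℝ) < n := by exact_mod_cast hi
    rw [e] at hm hf ⊢
    rw [Nat.cast_sub hk.le] at hm ⊢
    intro hlt
    have hma : m < a := by
      by_contra hc; push Not at hc; nlinarith
    by_cases hik : i = k
    · subst hik; linarith
    · have := hf i (by simp; omega) hik (by omega)
      nlinarith

/-- The walk stays above the line of slope `a`. -/
def StaysAbove (a : ℝ) (x : ℕ → ℝ) : Prop := ∀ i, 0 < i → a * i < psum x i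

lemma measurableSet_staysAbove (a : ℝ) : MeasurableSet {x | StaysAbove a x} := by
  unfold StaysAbove
  simp only [ofPred_forall]
  exact .iInter fun i => .iInter fun _ => measurableSet_lt measurable_const (by fun_prop)

/-- The two conditions involve the first `n` steps and the later steps respectively, hence are
independent. -/
lemma isGlobalArgmin_iff (a : ℝ) (x : ℕ → ℝ) (n : ℕ) :
    IsGlobalArgmin a (psum x) n ↔
      (∀ i < n, psum x n - a * n < psum x i - a * i) ∧ StaysAbove a fun i => x (n + i) := by
  unfold IsGlobalArgmin StaysAbove
  simp only [psum_shift]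
  constructor
  · refine fun h => ⟨fun i hi => h i hi.ne, fun i hi => ?_⟩
    have := h (n + i) (by omega)
    push_cast at this; linarith
  · rintro ⟨h1, h2⟩ i hi
    rcases lt_or_gt_of_ne hi with h | h
    · exact h1 i h
    · obtain ⟨l, rfl⟩ : ∃ l, i = n + l := ⟨i - n, by omega⟩
      have := h2 l (by omega)
      push_cast; linarith

lemma meanFaceProd_mono {ν : Measure ℝ} {g g' : ℕ → ℝ → ℝ≥0∞} (h : ∀ j x, g j x ≤ g' j x) (n : ℕ) :
    meanFaceProd ν g n ≤ meanFaceProd ν g' n :=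
  lintegral_mono fun _ => Finset.prod_le_prod' fun _ _ => h _ _

lemma meanFaceProd_le_one {ν : Measure ℝ} [IsProbabilityMeasure ν] {g : ℕ → ℝ → ℝ≥0∞} (h : ∀ j x, g j x ≤ 1) (n : ℕ) :
    meanFaceProd ν g n ≤ 1 := by
  refine (lintegral_mono fun _ => Finset.prod_le_one' fun _ _ => h _ _).trans ?_
  simp

section LaplaceFunctional

variable {ν : Measure ℝ} [IsProbabilityMeasure ν] [NullSingletonClass ν]

open Classical in
-- Decomposition at the time of the minimum of the tilted walk: the cut product carries the
-- condition on the past, and the condition on the future always has the same probability. The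
-- functional `R` is left general so that it can also be the constant 1.
lemma lintegral_eq_tsum_meanFaceProd {a : ℝ}
    (hmin : ∀ᵐ x ∂iidLaw ν, ∃ n, IsGlobalArgmin a (psum x) n) {g : ℕ → ℝ → ℝ≥0∞}
    (hg : ∀ j, Measurable (g j)) {R : (ℕ → ℝ) → ℝ≥0∞}
    (hR : ∀ x n, IsGlobalArgmin a (psum x) n → R x = faceProd g n (psum x)) :
    ∫⁻ x, R x ∂iidLaw ν =
      (∑' n, meanFaceProd ν (slopeCut a g) n) * iidLaw ν {x | StaysAbove a x} := by
  have hm1 := measurable_faceProd (measurable_slopeCut a hg)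
  have hm2 : Measurable fun x => if StaysAbove a x then (1 : ℝ≥0∞) else 0 :=
    Measurable.ite (measurableSet_staysAbove a) measurable_const measurable_const
  have h1 : ∫⁻ x, R x ∂iidLaw ν = ∫⁻ x, ∑' n, faceProd (slopeCut a g) n (psum x) *
      (if StaysAbove a (fun i => x (n + i)) then 1 else 0) ∂iidLaw ν := by
    refine lintegral_congr_ae ?_
    filter_upwards [hmin, ae_isGeneric ν] with x hx hgen
    obtain ⟨n, hn⟩ := hx
    have h2 := (isGlobalArgmin_iff a x n).1 hn
    rw [tsum_eq_single n, faceProd_slopeCut a g hgen, if_pos h2.1, if_pos h2.2, mul_one, hR x n hn]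
    intro l hl
    rw [faceProd_slopeCut a g hgen]
    by_contra hne
    rw [mul_eq_zero, not_or] at hne
    simp only [ite_eq_right_iff, not_forall, exists_prop, one_ne_zero, not_false_eq_true,
      and_true] at hne
    have h3 := (isGlobalArgmin_iff a x l).2 ⟨hne.1.1, hne.2⟩
    exact lt_asymm (hn l hl) (h3 n hl.symm)
  have hm3 : ∀ n, Measurable fun x => faceProd (slopeCut a g) n (psum x) *
      (if StaysAbove a (fun i => x (n + i)) then (1 : ℝ≥0∞) else 0) := fun n => (hm1 n).mul
    (hm2.comp (by fun_prop : Measurable fun (x : ℕ → ℝ) i => x (n + i)))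
  rw [h1, lintegral_tsum fun n => (hm3 n).aemeasurable, ← ENNReal.tsum_mul_right]
  refine tsum_congr fun n => ?_
  rw [lintegral_iidLaw_mul_shift (hm1 n) hm2, meanFaceProd]
  · congr 1
    have : (fun x => if StaysAbove a x then (1 : ℝ≥0∞) else 0) =
        {x | StaysAbove a x}.indicator 1 := by
      funext x; simp [indicator_apply]
    rw [this, lintegral_indicator_one (measurableSet_staysAbove a)]
  · intro x y hxy
    exact faceProd_congr fun i hi => psum_congr fun l hl => hxy l (by simp; omega)

/-- The sum of the expected products over faces, when it is finite. -/
lemma tsum_meanFaceProd {g : ℕ → ℝ → ℝ≥0∞} (hg : ∀ j, Measurable (g j)) (h1 : ∀ j x, g j x ≤ 1)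
    (hfin : ∑' n, meanFaceProd ν g n ≠ ∞) :
    (Summable fun k : ℕ => (∫⁻ x, g (k + 1) (psum x (k + 1)) ∂iidLaw ν).toReal / (k + 1)) ∧
      (∑' n, meanFaceProd ν g n).toReal =
        Real.exp (∑' k : ℕ, (∫⁻ x, g (k + 1) (psum x (k + 1)) ∂iidLaw ν).toReal / (k + 1)) := by
  have hle := meanFaceProd_le_one (ν := ν) h1
  have hψ : ∀ j, ∫⁻ x, g j (psum x j) ∂iidLaw ν ≤ 1 := fun j =>
    (lintegral_mono fun x => h1 j _).trans (by simp)
  have hne : ∀ n, meanFaceProd ν g n ≠ ∞ := fun n => ((hle n).trans_lt ENNReal.one_lt_top).ne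
  have hψne : ∀ j, ∫⁻ x, g j (psum x j) ∂iidLaw ν ≠ ∞ := fun j =>
    ((hψ j).trans_lt ENNReal.one_lt_top).ne
  rw [ENNReal.tsum_toReal_eq hne]
  -- Here `γ k` belongs to length `k + 1`, so the divisor `k + 1` is the length.
  refine one_add_tsum_eq_exp (φ := fun n => (meanFaceProd ν g n).toReal)
    (γ := fun k => (∫⁻ x, g (k + 1) (psum x (k + 1)) ∂iidLaw ν).toReal) ?_
    (fun n => ENNReal.toReal_nonneg) (fun n => ?_) (fun n => ENNReal.toReal_nonneg) (fun n => ?_)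
    (fun n => ?_) (ENNReal.summable_toReal hfin)
  · simp [meanFaceProd_zero]
  · exact ENNReal.toReal_le_of_le_ofReal zero_le_one (by simpa using hle n)
  · exact ENNReal.toReal_le_of_le_ofReal zero_le_one (by simpa using hψ _)
  · have h := congrArg ENNReal.toReal (mul_meanFaceProd (ν := ν) hg (n + 1))
    rw [ENNReal.toReal_mul, ENNReal.toReal_natCast, ENNReal.toReal_sum fun j _ =>
      ENNReal.mul_ne_top (hψne j) (hne _)] at h
    push_cast at h
    rw [h, Finset.sum_bij' (fun j _ => j - 1) (fun k _ => k + 1)]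
    · intro j hj; rw [Finset.mem_Icc] at hj; rw [Finset.mem_range]; omega
    · intro k hk; rw [Finset.mem_range] at hk; rw [Finset.mem_Icc]; omega
    · intro j hj; rw [Finset.mem_Icc] at hj; exact Nat.sub_add_cancel hj.1
    · intro k _; rfl
    · intro j hj
      rw [Finset.mem_Icc] at hj
      obtain ⟨k, rfl⟩ : ∃ k, j = k + 1 := ⟨j - 1, by omega⟩
      simp only [Nat.add_sub_cancel, ENNReal.toReal_mul]
      rw [show n + 1 - (k + 1) = n - k by omega]

/-- The Laplace functional of the faces of slope less than `a`. -/
lemma lintegral_faces_slope_lt {a : ℝ}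
    (hmin : ∀ᵐ x ∂iidLaw ν, ∃ n, IsGlobalArgmin a (psum x) n) {g : ℕ → ℝ → ℝ≥0∞}
    (hg : ∀ j, Measurable (g j)) (h1 : ∀ j x, g j x ≤ 1) {R : (ℕ → ℝ) → ℝ≥0∞}
    (hR : ∀ x n, IsGlobalArgmin a (psum x) n → R x = faceProd g n (psum x)) :
    (∑' k : ℕ, (k + 1 : ℝ≥0∞)⁻¹ * ∫⁻ x, slopeCut a (fun j y => 1 - g j y) (k + 1)
        (psum x (k + 1)) ∂iidLaw ν) ≠ ∞ ∧
    ∫⁻ x, R x ∂iidLaw ν = ENNReal.ofReal (Real.exp (-(∑' k : ℕ, (k + 1 : ℝ≥0∞)⁻¹ *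
      ∫⁻ x, slopeCut a (fun j y => 1 - g j y) (k + 1) (psum x (k + 1)) ∂iidLaw ν).toReal)) := by
  set p := iidLaw ν {x | StaysAbove a x}
  -- The weight 1 shows that `p` is the reciprocal of the corresponding sum. So `p` is nonzero and
  -- this sum, which dominates the one for `g`, is finite.
  have hone := lintegral_eq_tsum_meanFaceProd hmin (g := fun _ _ => 1) (fun _ => measurable_const)
    (R := fun _ => 1) (fun x n _ => by simp [faceProd])
  rw [lintegral_const, measure_univ, one_mul] at hone
  have hcut : ∀ {g : ℕ → ℝ → ℝ≥0∞}, (∀ j x, g j x ≤ 1) → ∀ j x, slopeCut a g j x ≤ 1 :=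
    fun {g} h j x => by unfold slopeCut; split_ifs <;> simp [h]
  have hp0 : p ≠ 0 := fun h => by simp [p] at h; simp [h] at hone
  have hΦ1 : ∑' n, meanFaceProd ν (slopeCut a fun _ _ => 1) n ≠ ∞ := fun h => by
    rw [h, ENNReal.top_mul hp0] at hone; exact ENNReal.one_ne_top hone
  have hΦ : ∑' n, meanFaceProd ν (slopeCut a g) n ≠ ∞ :=
    ne_top_of_le_ne_top hΦ1 (ENNReal.tsum_le_tsum fun n => meanFaceProd_mono
      (fun j x => by unfold slopeCut; split_ifs <;> simp [h1]) n)
  obtain ⟨hs1, he1⟩ := tsum_meanFaceProd (ν := ν)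
    (measurable_slopeCut a fun _ => measurable_const) (hcut fun _ _ => le_rfl) hΦ1
  obtain ⟨hs, he⟩ := tsum_meanFaceProd (ν := ν) (measurable_slopeCut a hg) (hcut h1) hΦ
  set ψ₁ : ℕ → ℝ≥0∞ := fun k => ∫⁻ x, slopeCut a (fun _ _ => 1) (k + 1) (psum x (k + 1)) ∂iidLaw ν
  set ψ : ℕ → ℝ≥0∞ := fun k => ∫⁻ x, slopeCut a g (k + 1) (psum x (k + 1)) ∂iidLaw ν
  set w : ℕ → ℝ≥0∞ := fun k =>
    ∫⁻ x, slopeCut a (fun j y => 1 - g j y) (k + 1) (psum x (k + 1)) ∂iidLaw ν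
  have hadd : ∀ k, ψ₁ k = ψ k + w k := fun k => by
    have hm : Measurable fun x => slopeCut a g (k + 1) (psum x (k + 1)) :=
      (measurable_slopeCut a hg (k + 1)).comp (measurable_psum _)
    refine Eq.trans (lintegral_congr fun x => ?_) (lintegral_add_left hm _)
    unfold slopeCut
    split_ifs
    · rw [add_tsub_cancel_of_le (h1 _ _)]
    · simp
  have hψ1 : ∀ k, ψ₁ k ≠ ∞ := fun k =>
    ((lintegral_mono fun x => hcut (fun _ _ => le_rfl) _ _).trans_lt
      (by simp : ∫⁻ _ : ℕ → ℝ, 1 ∂iidLaw ν < ∞)).ne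
  have hψ : ∀ k, ψ k ≠ ∞ := fun k => ne_top_of_le_ne_top (hψ1 k) (by rw [hadd]; exact le_self_add)
  have hw : ∀ k, w k ≠ ∞ := fun k => ne_top_of_le_ne_top (hψ1 k) (by rw [hadd]; exact le_add_self)
  have hwr : ∀ k, (w k).toReal / (k + 1) = (ψ₁ k).toReal / (k + 1) - (ψ k).toReal / (k + 1) :=
    fun k => by rw [hadd, ENNReal.toReal_add (hψ k) (hw k)]; ring
  have hwt : ∀ k : ℕ, ((k + 1 : ℝ≥0∞)⁻¹ * w k).toReal = (w k).toReal / (k + 1) := fun k => by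
    rw [ENNReal.toReal_mul, ENNReal.toReal_inv, ENNReal.toReal_add (by simp) (by simp)]
    simp; field_simp
  have hinv : ∀ k : ℕ, (k + 1 : ℝ≥0∞)⁻¹ * w k ≠ ∞ := fun k =>
    ENNReal.mul_ne_top (by simp) (hw k)
  have hsw : Summable fun k : ℕ => (w k).toReal / (k + 1) := by
    simp only [hwr]; exact hs1.sub hs
  have hfin : ∑' k : ℕ, (k + 1 : ℝ≥0∞)⁻¹ * w k ≠ ∞ := by
    have e : ∀ k : ℕ, (k + 1 : ℝ≥0∞)⁻¹ * w k = ENNReal.ofReal ((w k).toReal / (k + 1)) := fun k => by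
      rw [← hwt, ENNReal.ofReal_toReal (hinv k)]
    simp only [e]
    exact hsw.tsum_ofReal_ne_top
  refine ⟨hfin, ?_⟩
  rw [lintegral_eq_tsum_meanFaceProd hmin hg hR]
  rw [ENNReal.tsum_toReal_eq hinv]
  simp only [hwt, hwr]
  -- Replacing `p` by that reciprocal leaves a quotient of two exponentials, whose exponents differ
  -- by the terms of `w`.
  rw [hs1.tsum_sub hs, neg_sub, Real.exp_sub, ← he, ← he1, ENNReal.ofReal_div_of_pos,
    ENNReal.ofReal_toReal hΦ, ENNReal.ofReal_toReal hΦ1, div_eq_mul_inv]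
  · congr 1
    exact ENNReal.eq_inv_of_mul_eq_one_left (by rw [mul_comm]; exact hone.symm)
  · rw [he1]; exact Real.exp_pos _

end LaplaceFunctional

/-! ### The convex minorant of an infinite sequence -/

lemma IsConvexBelow.le_chord {s : ℕ → ℝ} {f : ℝ → ℝ} (hf : IsConvexBelow s f) {k j : ℕ}
    (hj : 0 < j) {t : ℝ} (h1 : (k : ℝ) ≤ t) (h2 : t ≤ k + j) :
    f t ≤ s k + (s (k + j) - s k) / j * (t - k) := by
  have hjR : (0 : ℝ) < j := by exact_mod_cast hj
  have hk : (0 : ℝ) ≤ k := Nat.cast_nonneg k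
  have w1 : 0 ≤ ((k : ℝ) + j - t) / j := div_nonneg (by linarith) hjR.le
  have w2 : 0 ≤ (t - (k : ℝ)) / j := div_nonneg (by linarith) hjR.le
  have h := hf.1.2 (show (k : ℝ) ∈ Ici 0 from hk)
    (show ((k + j : ℕ) : ℝ) ∈ Ici (0 : ℝ) from mem_Ici.2 (Nat.cast_nonneg _)) w1 w2 (by field_simp; ring)
  have e : (((k : ℝ) + j - t) / j) • (k : ℝ) + ((t - (k : ℝ)) / j) • ((k + j : ℕ) : ℝ) = t := by
    simp only [smul_eq_mul]; push_cast; field_simp; ring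
  rw [e] at h
  refine h.trans ?_
  have a1 : (k + j - t) / j * f k ≤ (k + j - t) / j * s k :=
    mul_le_mul_of_nonneg_left (hf.2 k) w1
  have a2 : (t - k) / j * f (k + j : ℕ) ≤ (t - k) / j * s (k + j) :=
    mul_le_mul_of_nonneg_left (hf.2 (k + j)) w2
  simp only [smul_eq_mul]
  refine (add_le_add a1 a2).trans (le_of_eq ?_)
  field_simp; ring

/-- The chord over the unit interval containing `t` bounds every candidate; without a bound, the
real supremum in `convexMinorant` would take its default value. -/
lemma bddAbove_isConvexBelow (s : ℕ → ℝ) {t : ℝ} (ht : 0 ≤ t) :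
    BddAbove {y : ℝ | ∃ f : ℝ → ℝ, IsConvexBelow s f ∧ y = f t} := by
  refine ⟨s ⌊t⌋₊ + (s (⌊t⌋₊ + 1) - s ⌊t⌋₊) / (1 : ℕ) * (t - ⌊t⌋₊), ?_⟩
  rintro y ⟨f, hf, rfl⟩
  exact hf.le_chord (k := ⌊t⌋₊) (j := 1) one_pos (Nat.floor_le ht)
    (by push_cast; exact (Nat.lt_floor_add_one t).le)

lemma IsConvexBelow.le_convexMinorant {s : ℕ → ℝ} {f : ℝ → ℝ} (hf : IsConvexBelow s f) {t : ℝ}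
    (ht : 0 ≤ t) : f t ≤ convexMinorant s t :=
  le_csSup (bddAbove_isConvexBelow s ht) ⟨f, hf, rfl⟩

lemma isGreatestConvexMinorant_convexMinorant {s : ℕ → ℝ} (h : ∃ f, IsConvexBelow s f) :
    IsGreatestConvexMinorant s (convexMinorant s) := by
  obtain ⟨f₀, hf₀⟩ := h
  refine ⟨⟨⟨convex_Ici 0, ?_⟩, fun n => ?_⟩, fun f hf t ht => hf.le_convexMinorant ht⟩
  · intro x hx y hy a b ha hb hab
    refine csSup_le ⟨_, f₀, hf₀, rfl⟩ ?_
    rintro _ ⟨f, hf, rfl⟩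
    refine (hf.1.2 hx hy ha hb hab).trans (add_le_add ?_ ?_)
    · exact mul_le_mul_of_nonneg_left (hf.le_convexMinorant hx) ha
    · exact mul_le_mul_of_nonneg_left (hf.le_convexMinorant hy) hb
  · refine csSup_le ⟨_, f₀, hf₀, rfl⟩ ?_
    rintro _ ⟨f, hf, rfl⟩
    exact hf.2 n

lemma isConvexBelow_affine {s : ℕ → ℝ} {a b : ℝ} (h : ∀ n : ℕ, a + b * n ≤ s n) :
    IsConvexBelow s fun t => a + b * t := by
  refine ⟨⟨convex_Ici 0, fun x _ y _ u v _ _ huv => le_of_eq ?_⟩, h⟩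
  simp only [smul_eq_mul]
  linear_combination (-a) * huv

lemma IsStrictFace.le {s : ℕ → ℝ} {k j : ℕ} (hj : 0 < j) (h : IsStrictFace univ s k j) (i : ℕ) :
    s k + (s (k + j) - s k) / j * ((i : ℝ) - k) ≤ s i := by
  by_cases h1 : i = k
  · subst h1; simp
  by_cases h2 : i = k + j
  · subst h2; push_cast; have := slope_spec s k hj; rw [add_sub_cancel_left]; exact this.ge
  exact (h i (mem_univ i) h1 h2).le

lemma IsStrictFace.isConvexBelow {s : ℕ → ℝ} {k j : ℕ} (hj : 0 < j)
    (h : IsStrictFace univ s k j) :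
    IsConvexBelow s fun t =>
      (s k - (s (k + j) - s k) / j * k) + (s (k + j) - s k) / j * t :=
  isConvexBelow_affine fun n => by have := h.le hj n; linarith

lemma isVertex_of_isConvexBelow {s : ℕ → ℝ} {f : ℝ → ℝ} (hf : IsConvexBelow s f) {k : ℕ}
    (h : f k = s k) : IsVertex s k := by
  refine le_antisymm ?_ ?_
  · rw [← h]; exact hf.le_convexMinorant (Nat.cast_nonneg k)
  · refine csSup_le ⟨_, f, hf, rfl⟩ ?_
    rintro _ ⟨f', hf', rfl⟩
    exact hf'.2 k

lemma IsStrictFace.isVertex_left {s : ℕ → ℝ} {k j : ℕ} (hj : 0 < j)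
    (h : IsStrictFace univ s k j) : IsVertex s k :=
  isVertex_of_isConvexBelow (h.isConvexBelow hj) (by ring)

lemma IsStrictFace.isVertex_right {s : ℕ → ℝ} {k j : ℕ} (hj : 0 < j)
    (h : IsStrictFace univ s k j) : IsVertex s (k + j) :=
  isVertex_of_isConvexBelow (h.isConvexBelow hj) (by
    have := slope_spec s k hj
    push_cast; linarith)

lemma IsStrictFace.not_isVertex {s : ℕ → ℝ} {k j : ℕ} (hj : 0 < j)
    (h : IsStrictFace univ s k j) {i : ℕ} (h1 : k < i) (h2 : i < k + j) : ¬ IsVertex s i := by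
  intro hv
  have h3 := h i (mem_univ i) h1.ne' h2.ne
  rw [hv] at h3
  refine h3.not_ge (csSup_le ⟨_, _, h.isConvexBelow hj, rfl⟩ ?_)
  rintro _ ⟨f, hf, rfl⟩
  exact hf.le_chord hj (by exact_mod_cast h1.le) (by exact_mod_cast h2.le)

/-! ### Faces of an infinite sequence with a given asymptotic slope. -/

/-- The walk drifts to infinity faster than any slope less than `M`, and from each index its
slopes come down to `M`. -/
structure HasSlope (M : EReal) (s : ℕ → ℝ) : Prop where
  tendsto : ∀ a : ℝ, (a : EReal) < M →
    Filter.Tendsto (fun n : ℕ => s n - a * n) Filter.atTop Filter.atTop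
  exists_le : ∀ k, ∃ l > k, (((s l - s k) / ((l : ℝ) - k) : ℝ) : EReal) ≤ M

section HasSlope

variable {M : EReal} {s : ℕ → ℝ}

/-- If some slope from `k` is less than `M`, the drift leaves finitely many competitors. Otherwise
all slopes are at least `M`, and the one provided by `exists_le` is minimal. -/
lemma HasSlope.exists_min_slope (hs : HasSlope M s) (k : ℕ) :
    ∃ l > k, ∀ i > k, (s l - s k) / ((l : ℝ) - k) ≤ (s i - s k) / ((i : ℝ) - k) := by
  obtain ⟨l₀, hl₀, hle⟩ := hs.exists_le k
  by_cases hc : ∃ l > k, (((s l - s k) / ((l : ℝ) - k) : ℝ) : EReal) < M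
  · obtain ⟨l₁, hl₁, hlt⟩ := hc
    set c := (s l₁ - s k) / ((l₁ : ℝ) - k) with hcdef
    obtain ⟨N, hN⟩ := Filter.eventually_atTop.1
      ((hs.tendsto c hlt).eventually_ge_atTop (s k - c * k))
    obtain ⟨l, hl, hmin⟩ := (Finset.Ioc k (max N l₁)).exists_min_image
      (fun i => (s i - s k) / ((i : ℝ) - k)) ⟨l₁, by simp [hl₁]⟩
    rw [Finset.mem_Ioc] at hl
    refine ⟨l, hl.1, fun i hi => ?_⟩
    by_cases hiN : i ≤ max N l₁
    · exact hmin i (Finset.mem_Ioc.2 ⟨hi, hiN⟩)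
    · refine (hmin l₁ (Finset.mem_Ioc.2 ⟨hl₁, le_max_right _ _⟩)).trans ?_
      have := hN i (by omega)
      have hik : (0 : ℝ) < (i : ℝ) - k := by
        have : (k : ℝ) < i := by exact_mod_cast hi
        linarith
      rw [← hcdef, le_div_iff₀ hik]
      linarith
  · push Not at hc
    refine ⟨l₀, hl₀, fun i hi => ?_⟩
    exact EReal.coe_le_coe_iff.1 (hle.trans (hc i hi))

lemma HasSlope.exists_next (hs : HasSlope M s) (hg : IsGeneric s) (k : ℕ) :
    ∃ j > 0, ∀ i > k, i ≠ k + j → s k + (s (k + j) - s k) / j * ((i : ℝ) - k) < s i := by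
  obtain ⟨l, hl, hmin⟩ := hs.exists_min_slope k
  obtain ⟨j, rfl⟩ : ∃ j, l = k + j := ⟨l - k, by omega⟩
  refine ⟨j, by omega, fun i hi hne => ?_⟩
  have h1 := hmin i hi
  have hik : (0 : ℝ) < (i : ℝ) - k := by
    have : (k : ℝ) < i := by exact_mod_cast hi
    linarith
  have hjR : (0 : ℝ) < j := by exact_mod_cast (by omega : 0 < j)
  push_cast at h1
  rw [add_sub_cancel_left] at h1
  have h2 : (s (k + j) - s k) / j < (s i - s k) / ((i : ℝ) - k) := by
    refine h1.lt_of_ne fun h => hne ?_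
    rw [div_eq_div_iff hjR.ne' hik.ne'] at h
    exact (hg k i k (k + j) hi (by omega) (by push_cast; linear_combination h)).2
  rw [lt_div_iff₀ hik] at h2
  linarith

lemma HasSlope.exists_face_zero (hs : HasSlope M s) (hg : IsGeneric s) :
    ∃ j > 0, IsStrictFace univ s 0 j := by
  obtain ⟨j, hj, h⟩ := hs.exists_next hg 0
  exact ⟨j, hj, fun i _ h1 h2 => h i (Nat.pos_of_ne_zero h1) h2⟩

/-- The endpoint of the new chord lies above the old line, so the new slope is larger. To the left
of `k + j` the new line is then below the old one, which is below the sequence. -/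
lemma HasSlope.exists_face_next (hs : HasSlope M s) (hg : IsGeneric s) {k j : ℕ} (hj : 0 < j)
    (hf : IsStrictFace univ s k j) : ∃ j' > 0, IsStrictFace univ s (k + j) j' := by
  obtain ⟨j', hj', h⟩ := hs.exists_next hg (k + j)
  refine ⟨j', hj', fun i _ h1 h2 => ?_⟩
  rcases lt_or_gt_of_ne h1 with h3 | h3
  · have hle := hf.le hj i
    have hlt := hf (k + j + j') (mem_univ _) (by omega) (by omega)
    have e1 := slope_spec s k hj
    have e2 := slope_spec s (k + j) hj'
    set m := (s (k + j) - s k) / j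
    set m' := (s (k + j + j') - s (k + j)) / j'
    have hjR : (0 : ℝ) < j' := by exact_mod_cast hj'
    have hmm : m < m' := by
      rw [e2, e1] at hlt
      push_cast at hlt
      by_contra hc; push Not at hc; nlinarith
    have h4 : (i : ℝ) < (k + j : ℕ) := by exact_mod_cast h3
    rw [e1]
    push_cast at h4 ⊢
    nlinarith
  · exact h i h3 h2

lemma HasSlope.exists_face_mem (hs : HasSlope M s) (hg : IsGeneric s) (i : ℕ) :
    ∃ k j, 0 < j ∧ IsStrictFace univ s k j ∧ k ≤ i ∧ i < k + j := by
  induction i with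
  | zero =>
    obtain ⟨j, hj, h⟩ := hs.exists_face_zero hg
    exact ⟨0, j, hj, h, le_rfl, by omega⟩
  | succ i ih =>
    obtain ⟨k, j, hj, h, h1, h2⟩ := ih
    by_cases hi : i + 1 < k + j
    · exact ⟨k, j, hj, h, by omega, hi⟩
    · obtain ⟨j', hj', h'⟩ := hs.exists_face_next hg hj h
      exact ⟨k + j, j', hj', h', by omega, by omega⟩

/-- The faces of the convex minorant are the strict faces. -/
lemma HasSlope.faces_eq (hs : HasSlope M s) (hg : IsGeneric s) :
    faces s = {p | IsStrictFace univ s p.1 p.2} := by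
  ext ⟨k, j⟩
  have hj := j.pos
  constructor
  · rintro ⟨h1, h2, h3⟩
    simp only at h1 h2 h3
    obtain ⟨k', j', hj', hf, hk1, hk2⟩ := hs.exists_face_mem hg k
    have hk : k' = k := by
      by_contra hne
      exact hf.not_isVertex hj' (by omega) hk2 h1
    subst hk
    have hjj : j' = j := by
      rcases lt_trichotomy j' j with h | h | h
      · exact absurd (hf.isVertex_right hj') (h3 _ (by omega) (by omega))
      · exact h
      · exact absurd h2 (hf.not_isVertex hj' (by omega) (by omega))
    exact (hjj ▸ hf : IsStrictFace univ s k' j)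
  · intro (h : IsStrictFace univ s k j)
    exact ⟨h.isVertex_left hj, h.isVertex_right hj, fun i h1 h2 => h.not_isVertex hj h1 h2⟩

lemma HasSlope.isGreatestConvexMinorant (hs : HasSlope M s) (hg : IsGeneric s) :
    IsGreatestConvexMinorant s (convexMinorant s) := by
  obtain ⟨j, hj, h⟩ := hs.exists_face_zero hg
  exact isGreatestConvexMinorant_convexMinorant ⟨_, h.isConvexBelow hj⟩

/-- From the end of the face some later slope is at most `M`, and that later point lies strictly
above the line of the face. -/
lemma HasSlope.slope_lt (hs : HasSlope M s) {k j : ℕ} (hj : 0 < j)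
    (hf : IsStrictFace univ s k j) : (((s (k + j) - s k) / j : ℝ) : EReal) < M := by
  obtain ⟨l, hl, hle⟩ := hs.exists_le (k + j)
  refine lt_of_lt_of_le ?_ hle
  rw [EReal.coe_lt_coe_iff]
  have h1 := hf l (mem_univ l) (by omega) (by omega)
  have e1 := slope_spec s k hj
  set m := (s (k + j) - s k) / j
  have h2 : (0 : ℝ) < (l : ℝ) - (k + j : ℕ) := by
    have : ((k + j : ℕ) : ℝ) < l := by exact_mod_cast hl
    linarith
  rw [lt_div_iff₀ h2, e1]
  push_cast
  linarith

end HasSlope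

/-- The faces with slope less than `a` are the faces up to the minimum of the tilted walk. -/
lemma IsGlobalArgmin.mem_finiteFaces_iff {a : ℝ} {s : ℕ → ℝ} {n : ℕ} (hn : IsGlobalArgmin a s n)
    {k j : ℕ} (hj : 0 < j) :
    (k, j) ∈ finiteFaces n s ↔ IsStrictFace univ s k j ∧ s (k + j) - s k < a * j := by
  have hm := slope_spec s k hj
  have hjR : (0 : ℝ) < j := by exact_mod_cast hj
  rw [mem_finiteFaces]
  simp only
  rw [isStrictFace_iff hj hm, isStrictFace_iff hj hm]
  set m := (s (k + j) - s k) / j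
  constructor
  · rintro ⟨-, hkn, hf⟩
    have hkn' : k < n := by omega
    have hknR : (k : ℝ) < n := by exact_mod_cast hkn'
    have h1 := hn k hkn'.ne
    have hle : s k + m * ((n : ℝ) - k) ≤ s n := by
      rcases hkn.eq_or_lt with h | h
      · rw [← h, hm]; push_cast; linarith
      · exact (hf n (by simp) (by omega) (by omega)).le
    have hma : m < a := by
      by_contra hc; push Not at hc; nlinarith
    refine ⟨fun i _ h2 h3 => ?_, by rw [hm]; nlinarith⟩
    by_cases hi : i ≤ n
    · exact hf i hi h2 h3
    · have h4 := hn i (by omega)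
      have h5 : (n : ℝ) < i := by exact_mod_cast (by omega : n < i)
      nlinarith
  · rintro ⟨hf, hlt⟩
    have hma : m < a := by
      rw [hm] at hlt
      by_contra hc; push Not at hc; nlinarith
    refine ⟨hj, ?_, fun i _ h2 h3 => hf i (mem_univ i) h2 h3⟩
    -- The line of the face is at most `s n` at `n` and its slope is less than `a`; an endpoint
    -- after `n` would have a tilted value less than the minimum.
    by_contra hc
    have h1 := hn (k + j) (by omega)
    have h2 : (n : ℝ) < (k + j : ℕ) := by exact_mod_cast (by omega : n < k + j)
    have hle : s k + m * ((n : ℝ) - k) ≤ s n := by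
      by_cases h : n = k
      · rw [h]; simp
      · exact (hf n (mem_univ n) h (by omega)).le
    rw [hm] at h1
    push_cast at h1 h2
    nlinarith

lemma exists_isGlobalArgmin {a : ℝ} {s : ℕ → ℝ}
    (h : Filter.Tendsto (fun n : ℕ => s n - a * n) Filter.atTop Filter.atTop)
    (hinj : ∀ p q : ℕ, p < q → s p - a * p ≠ s q - a * q) : ∃ n, IsGlobalArgmin a s n := by
  obtain ⟨N, hN⟩ := Filter.eventually_atTop.1 (h.eventually_gt_atTop (s 0 - a * (0 : ℕ)))
  obtain ⟨n, hn, hmin⟩ := (Finset.range (N + 1)).exists_min_image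
    (fun i : ℕ => s i - a * i) ⟨0, by simp⟩
  refine ⟨n, fun i hi => ?_⟩
  have hle : s n - a * n ≤ s i - a * i := by
    by_cases hiN : i < N + 1
    · exact hmin i (by simpa using hiN)
    · exact (hmin 0 (by simp)).trans (hN i (by omega)).le
  refine hle.lt_of_ne fun e => ?_
  rcases lt_or_gt_of_ne hi with h1 | h1
  · exact hinj i n h1 e.symm
  · exact hinj n i h1 e

/-! ### Asymptotic behaviour of the walk -/

lemma extendedExpectation_ne_bot {ν : Measure ℝ} (hneg : ∫⁻ y, ENNReal.ofReal (-y) ∂ν < ∞) :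
    extendedExpectation ν (fun y => y) ≠ ⊥ := by
  unfold extendedExpectation
  rw [← ENNReal.ofReal_toReal hneg.ne, EReal.coe_ennreal_ofReal, max_eq_left ENNReal.toReal_nonneg]
  intro h
  rw [sub_eq_add_neg, EReal.add_eq_bot_iff] at h
  rcases h with h | h
  · exact EReal.coe_ennreal_ne_bot _ h
  · rw [← EReal.coe_neg] at h
    exact EReal.coe_ne_bot _ h

lemma integrable_of_extendedExpectation_ne_top {ν : Measure ℝ} (hneg : ∫⁻ y, ENNReal.ofReal (-y) ∂ν < ∞)
    (h : extendedExpectation ν (fun y => y) ≠ ⊤) :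
    Integrable (fun y => y) ν ∧ extendedExpectation ν (fun y => y) = ((∫ y, y ∂ν : ℝ) : EReal) := by
  have hpos : ∫⁻ y, ENNReal.ofReal y ∂ν ≠ ∞ := fun hc => h (by
    unfold extendedExpectation
    rw [hc, ← ENNReal.ofReal_toReal hneg.ne, EReal.coe_ennreal_ofReal,
      max_eq_left ENNReal.toReal_nonneg, EReal.coe_ennreal_top, EReal.top_sub_coe])
  have hint : Integrable (fun y : ℝ => y) ν := by
    refine ⟨by fun_prop, ?_⟩
    rw [hasFiniteIntegral_iff_norm]
    have : ∀ y : ℝ, ENNReal.ofReal ‖y‖ = ENNReal.ofReal y + ENNReal.ofReal (-y) := fun y => by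
      rcases le_total 0 y with hy | hy
      · rw [Real.norm_of_nonneg hy, ENNReal.ofReal_of_nonpos (by linarith : -y ≤ 0), add_zero]
      · rw [Real.norm_of_nonpos hy, ENNReal.ofReal_of_nonpos hy, zero_add]
    simp only [this]
    rw [lintegral_add_left (by fun_prop)]
    exact ENNReal.add_lt_top.2 ⟨hpos.lt_top, hneg⟩
  refine ⟨hint, ?_⟩
  rw [integral_eq_lintegral_pos_part_sub_lintegral_neg_part hint, extendedExpectation,
    ← ENNReal.ofReal_toReal hneg.ne, ← ENNReal.ofReal_toReal hpos, EReal.coe_ennreal_ofReal,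
    EReal.coe_ennreal_ofReal, max_eq_left ENNReal.toReal_nonneg,
    max_eq_left ENNReal.toReal_nonneg, EReal.coe_sub, ENNReal.toReal_ofReal ENNReal.toReal_nonneg,
    ENNReal.toReal_ofReal ENNReal.toReal_nonneg]

section Asymptotics

variable {ν : Measure ℝ} [IsProbabilityMeasure ν]

lemma ae_tendsto_average {f : ℝ → ℝ} (hf : Measurable f) (hint : Integrable f ν) :
    ∀ᵐ x ∂iidLaw ν, Filter.Tendsto (fun n : ℕ => psum (fun i => f (x i)) n / n) Filter.atTop
      (nhds (∫ y, f y ∂ν)) := by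
  have hmp : ∀ i : ℕ, MeasurePreserving (fun x : ℕ → ℝ => x i) (iidLaw ν) ν := fun i =>
    ⟨measurable_pi_apply i, Measure.infinitePi_map_eval (fun _ : ℕ => ν) i⟩
  have hiid : ∀ i : ℕ, (iidLaw ν).map (fun x => f (x i)) = ν.map f := fun i => by
    have h := Measure.map_map (μ := iidLaw ν) hf (measurable_pi_apply i)
    rw [(hmp i).map_eq] at h
    exact h.symm
  have h0 : iIndepFun (fun (i : ℕ) (x : ℕ → ℝ) => f (x i)) (iidLaw ν) :=
    iIndepFun_infinitePi (X := fun _ => f) fun _ => hf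
  have h := strong_law_ae_real (μ := iidLaw ν) (fun i x => f (x i))
    ((hmp 0).integrable_comp_of_integrable hint) (fun i j hij => h0.indepFun hij)
    (fun i => ⟨(hf.comp (measurable_pi_apply i)).aemeasurable,
      (hf.comp (measurable_pi_apply 0)).aemeasurable, by rw [hiid, hiid]⟩)
  have hmean : ∫ x, f (x 0) ∂iidLaw ν = ∫ y, f y ∂ν := by
    conv_rhs => rw [← (hmp 0).map_eq]
    rw [integral_map (measurable_pi_apply 0).aemeasurable hf.aestronglyMeasurable]
  rw [hmean] at h
  exact h

lemma integrable_min_const (hneg : ∫⁻ y, ENNReal.ofReal (-y) ∂ν < ∞) (K : ℝ) :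
    Integrable (fun y => min y K) ν := by
  have h1 : Integrable (fun y : ℝ => max (-y) 0) ν := by
    refine ⟨by fun_prop, ?_⟩
    rw [hasFiniteIntegral_iff_ofReal (Filter.Eventually.of_forall fun y => le_max_right (-y) 0)]
    simpa [ENNReal.ofReal_max] using hneg
  refine (h1.add (integrable_const |K|)).mono' (by fun_prop) (Filter.Eventually.of_forall fun y => ?_)
  simp only [Pi.add_apply, Real.norm_eq_abs]
  rw [abs_le]
  constructor
  · rcases le_total y K with h | h
    · rw [min_eq_left h]; linarith [le_max_left (-y) 0, abs_nonneg K]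
    · rw [min_eq_right h]; linarith [le_max_right (-y) 0, neg_abs_le K]
  · linarith [min_le_right y K, le_max_right (-y) 0, le_abs_self K]

/-- Truncation from above, by monotone convergence, reduces to integrable steps and so includes the
case of infinite mean. -/
lemma exists_lt_integral_min (hneg : ∫⁻ y, ENNReal.ofReal (-y) ∂ν < ∞) {a : ℝ}
    (ha : (a : EReal) < extendedExpectation ν fun y => y) :
    ∃ K : ℝ, a < ∫ y, min y K ∂ν := by
  set B := ∫⁻ y, ENNReal.ofReal (-y) ∂ν with hB
  have hsup : ∫⁻ y, ENNReal.ofReal y ∂ν = ⨆ n : ℕ, ∫⁻ y, ENNReal.ofReal (min y n) ∂ν := by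
    rw [← lintegral_iSup (f := fun (n : ℕ) (y : ℝ) => ENNReal.ofReal (min y n))
      (fun n => by fun_prop) (fun m n hmn y => ENNReal.ofReal_le_ofReal
        (min_le_min le_rfl (Nat.cast_le.2 hmn)))]
    refine lintegral_congr fun y => le_antisymm ?_ (iSup_le fun n =>
      ENNReal.ofReal_le_ofReal (min_le_left _ _))
    obtain ⟨n, hn⟩ := exists_nat_ge y
    exact le_iSup_of_le n (by rw [min_eq_left hn])
  -- Truncation at `n ≥ 0` keeps the negative part `B`, so the positive part must exceed `a + B`. A
  -- negative `a + B` is set apart because `ENNReal.ofReal` sends it to 0.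
  have h1 : ∃ n : ℕ, ENNReal.ofReal (a + B.toReal) < ∫⁻ y, ENNReal.ofReal (min y n) ∂ν ∨
      a + B.toReal < 0 := by
    by_cases hneg' : a + B.toReal < 0
    · exact ⟨0, .inr hneg'⟩
    have h2 : ENNReal.ofReal (a + B.toReal) < ∫⁻ y, ENNReal.ofReal y ∂ν := by
      by_contra hc
      push Not at hc hneg'
      unfold extendedExpectation at ha
      rw [← hB, ← ENNReal.ofReal_toReal hneg.ne] at ha
      have h3 := EReal.coe_ennreal_le_coe_ennreal_iff.2 hc
      rw [EReal.coe_ennreal_ofReal, max_eq_left hneg'] at h3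
      rw [EReal.coe_ennreal_ofReal, max_eq_left ENNReal.toReal_nonneg] at ha
      have h4 := ha.trans_le (EReal.sub_le_sub h3 (le_refl ((B.toReal : ℝ) : EReal)))
      rw [← EReal.coe_sub, add_sub_cancel_right] at h4
      exact lt_irrefl _ h4
    rw [hsup, lt_iSup_iff] at h2
    obtain ⟨n, hn⟩ := h2
    exact ⟨n, .inl hn⟩
  obtain ⟨n, hn⟩ := h1
  refine ⟨n, ?_⟩
  have hint := integrable_min_const hneg (n : ℝ)
  rw [integral_eq_lintegral_pos_part_sub_lintegral_neg_part hint]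
  have h5 : ∫⁻ y, ENNReal.ofReal (-min y (n : ℝ)) ∂ν = B := by
    refine lintegral_congr fun y => ?_
    rcases le_total y n with h | h
    · rw [min_eq_left h]
    · have hn0 : (0 : ℝ) ≤ n := Nat.cast_nonneg n
      rw [min_eq_right h, ENNReal.ofReal_of_nonpos (by linarith),
        ENNReal.ofReal_of_nonpos (by linarith)]
  rw [h5]
  rcases lt_or_ge (a + B.toReal) 0 with hlt | hge
  · have : 0 ≤ (∫⁻ y, ENNReal.ofReal (min y (n : ℝ)) ∂ν).toReal := ENNReal.toReal_nonneg
    linarith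
  · have hn := hn.resolve_right hge.not_gt
    have hfin : ∫⁻ y, ENNReal.ofReal (min y (n : ℝ)) ∂ν ≠ ∞ := by
      refine ((lintegral_mono fun y => ENNReal.ofReal_le_ofReal (min_le_right y (n : ℝ))).trans_lt
        ?_).ne
      simp
    have := (ENNReal.ofReal_lt_iff_lt_toReal hge hfin).1 hn
    linarith

lemma ae_tendsto_sub_atTop (hneg : ∫⁻ y, ENNReal.ofReal (-y) ∂ν < ∞) {a : ℝ}
    (ha : (a : EReal) < extendedExpectation ν fun y => y) :
    ∀ᵐ x ∂iidLaw ν, Filter.Tendsto (fun n : ℕ => psum x n - a * n) Filter.atTop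
      Filter.atTop := by
  obtain ⟨K, hK⟩ := exists_lt_integral_min hneg ha
  set c := ∫ y, min y K ∂ν
  filter_upwards [ae_tendsto_average (by fun_prop) (integrable_min_const hneg K)] with x hx
  have h1 : ∀ᶠ n : ℕ in Filter.atTop, (c - a) / 2 * n ≤ psum x n - a * n := by
    filter_upwards [hx.eventually_const_lt (show (a + c) / 2 < c by linarith),
      Filter.eventually_gt_atTop 0] with n hn hn0
    have hnR : (0 : ℝ) < n := by exact_mod_cast hn0
    rw [lt_div_iff₀ hnR] at hn
    have : psum (fun i => min (x i) K) n ≤ psum x n := Finset.sum_le_sum fun i _ => min_le_left _ _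
    linarith
  refine Filter.tendsto_atTop_mono' _ h1 ?_
  exact Filter.Tendsto.const_mul_atTop (by linarith) tendsto_natCast_atTop_atTop

/-- Rational slopes give a single null set, and the drift for a rational slope implies it for every
smaller slope. -/
lemma ae_forall_tendsto_sub_atTop (hneg : ∫⁻ y, ENNReal.ofReal (-y) ∂ν < ∞) :
    ∀ᵐ x ∂iidLaw ν, ∀ a : ℝ, (a : EReal) < extendedExpectation ν (fun y => y) →
      Filter.Tendsto (fun n : ℕ => psum x n - a * n) Filter.atTop Filter.atTop := by
  have h : ∀ᵐ x ∂iidLaw ν, ∀ q : ℚ, ((q : ℝ) : EReal) < extendedExpectation ν (fun y => y) →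
      Filter.Tendsto (fun n : ℕ => psum x n - (q : ℝ) * n) Filter.atTop Filter.atTop := by
    rw [ae_all_iff]
    intro q
    by_cases hq : ((q : ℝ) : EReal) < extendedExpectation ν fun y => y
    · filter_upwards [ae_tendsto_sub_atTop hneg hq] with x hx _ using hx
    · exact Filter.Eventually.of_forall fun x h => absurd h hq
  filter_upwards [h] with x hx a ha
  obtain ⟨q, hq1, hq2⟩ := EReal.lt_iff_exists_rat_btwn.1 ha
  refine Filter.tendsto_atTop_mono (fun n => ?_) (hx q hq2)
  have : a < q := by exact_mod_cast hq1
  have := mul_le_mul_of_nonneg_right this.le (Nat.cast_nonneg (α := ℝ) n)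
  linarith

/-! ### A walk returns to or below the line of its mean slope. -/

/-- The walk stays at distance `ε` above the line of slope `m`. -/
def StaysFarAbove (m ε : ℝ) (x : ℕ → ℝ) : Prop := ∀ i, 0 < i → m * i + ε ≤ psum x i

lemma measurableSet_staysFarAbove (m ε : ℝ) : MeasurableSet {x | StaysFarAbove m ε x} := by
  unfold StaysFarAbove
  simp only [ofPred_forall]
  exact .iInter fun i => .iInter fun _ => measurableSet_le measurable_const (by fun_prop)

open Classical in
-- Each index counted raises the tilted walk, at all later times, by at least `ε` above its value
-- there. The bound is kept for all `l ≥ n` so that in the induction it can be used at `n` itself.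
lemma sum_staysFarAbove_le {m ε : ℝ} {x : ℕ → ℝ} {k : ℕ} (hε : 0 ≤ ε)
    (hk : StaysFarAbove m ε fun i => x (k + i)) {n : ℕ} (hn : k ≤ n) : ∀ l, n ≤ l →
    ε * ∑ i ∈ Finset.Ico k n, (if StaysFarAbove m ε fun l => x (i + l) then (1 : ℝ) else 0) ≤
      (psum x l - m * l) - (psum x k - m * k) := by
  have key : ∀ {p l : ℕ}, (StaysFarAbove m ε fun i => x (p + i)) → p < l →
      ε ≤ (psum x l - m * l) - (psum x p - m * p) := fun {p l} hp hpl => by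
    obtain ⟨i, rfl⟩ : ∃ i, l = p + i := ⟨l - p, by omega⟩
    have := hp i (by omega)
    rw [psum_shift] at this
    push_cast; linarith
  induction n, hn using Nat.le_induction with
  | base =>
    intro l hl
    simp only [Finset.Ico_self, Finset.sum_empty, mul_zero]
    rcases hl.eq_or_lt with rfl | h
    · simp
    · exact hε.trans (key hk h)
  | succ n hn ih =>
    intro l hl
    rw [Finset.sum_Ico_succ_top hn, mul_add]
    split_ifs with h
    · have h1 := ih n le_rfl
      have h2 := key h (by omega : n < l)
      linarith
    · have := ih l (by omega)
      simpa using this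

open Classical in
-- The number of restart times `i < n` after which the walk stays `ε` above the line is, up to a
-- constant, at most `(S_n - m n) / ε`, which is o(n) by the law of large numbers. The mean
-- frequency of such times is the probability in question, hence 0.
lemma iidLaw_staysFarAbove_eq_zero (hint : Integrable (fun y => y) ν) {ε : ℝ} (hε : 0 < ε) :
    iidLaw ν {x | StaysFarAbove (∫ y, y ∂ν) ε x} = 0 := by
  set m := ∫ y, y ∂ν
  set I : ℕ → (ℕ → ℝ) → ℝ := fun k x =>
    if StaysFarAbove m ε fun l => x (k + l) then 1 else 0 with hI
  have hImeas : ∀ k, Measurable (I k) := fun k =>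
    (Measurable.ite (measurableSet_staysFarAbove m ε) measurable_const measurable_const).comp
      (by fun_prop : Measurable fun (x : ℕ → ℝ) l => x (k + l))
  have hI0 : ∀ k x, 0 ≤ I k x := fun k x => by simp only [hI]; split_ifs <;> simp
  have hI1 : ∀ k x, I k x ≤ 1 := fun k x => by simp only [hI]; split_ifs <;> simp
  have hIint : ∀ k, Integrable (I k) (iidLaw ν) := fun k =>
    (integrable_const (1 : ℝ)).mono' (hImeas k).aestronglyMeasurable
      (Filter.Eventually.of_forall fun x => by rw [Real.norm_of_nonneg (hI0 k x)]; exact hI1 k x)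
  have hImean : ∀ k, ∫ x, I k x ∂iidLaw ν = (iidLaw ν).real {x | StaysFarAbove m ε x} := fun k => by
    have hmap := Measure.map_infinitePi_infinitePi_of_inj (P := fun _ : ℕ => ν)
      (add_right_injective k)
    have h1 : ∫ x, ({x | StaysFarAbove m ε x}.indicator 1 x : ℝ) ∂iidLaw ν =
        ∫ x, I k x ∂iidLaw ν := by
      conv_lhs => rw [iidLaw, ← hmap]
      rw [integral_map (Measurable.aemeasurable (by fun_prop)) (measurable_one.indicator
        (measurableSet_staysFarAbove m ε)).aestronglyMeasurable]
      refine integral_congr_ae (Filter.Eventually.of_forall fun x => ?_)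
      simp [hI, indicator_apply]
    rw [← h1, integral_indicator_one (measurableSet_staysFarAbove m ε)]
  have hlim : ∀ᵐ x ∂iidLaw ν, Filter.Tendsto
      (fun n : ℕ => (∑ k ∈ Finset.range n, I k x) / n) Filter.atTop (nhds 0) := by
    filter_upwards [ae_tendsto_average measurable_id hint] with x hx
    -- Without any such index the frequency is 0. Otherwise the indices before `k` add at most `k`,
    -- negligible after division by `n`.
    by_cases hc : ∃ k, StaysFarAbove m ε fun l => x (k + l)
    · obtain ⟨k, hk⟩ := hc
      have hup : ∀ᶠ n : ℕ in Filter.atTop, (∑ k ∈ Finset.range n, I k x) / n ≤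
          ε⁻¹ * (psum x n / n - m) + (k - ε⁻¹ * (psum x k - m * k)) / n := by
        filter_upwards [Filter.eventually_gt_atTop 0, Filter.eventually_ge_atTop k] with n hn hkn
        have hnR : (0 : ℝ) < n := by exact_mod_cast hn
        have h1 := sum_staysFarAbove_le hε.le hk hkn n le_rfl
        have h2 : ∑ i ∈ Finset.range n, I i x ≤ k + ∑ i ∈ Finset.Ico k n, I i x := by
          rw [← Finset.sum_range_add_sum_Ico _ hkn]
          gcongr
          calc ∑ i ∈ Finset.range k, I i x ≤ ∑ i ∈ Finset.range k, (1 : ℝ) :=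
                Finset.sum_le_sum fun i _ => hI1 i x
            _ = k := by simp
        have h3 : ∑ i ∈ Finset.Ico k n, I i x ≤
            ε⁻¹ * ((psum x n - m * n) - (psum x k - m * k)) := by
          rw [← div_eq_inv_mul, le_div_iff₀ hε, mul_comm]; exact h1
        rw [div_le_iff₀ hnR]
        have e : (ε⁻¹ * (psum x n / n - m) + (k - ε⁻¹ * (psum x k - m * k)) / n) * n =
            k + ε⁻¹ * ((psum x n - m * n) - (psum x k - m * k)) := by
          field_simp; ring
        rw [e]; linarith
      refine tendsto_of_tendsto_of_tendsto_of_le_of_le' tendsto_const_nhds ?_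
        (Filter.Eventually.of_forall fun n => div_nonneg (Finset.sum_nonneg fun i _ => hI0 i x)
          (Nat.cast_nonneg n)) hup
      have h4 : Filter.Tendsto (fun n : ℕ => psum x n / n - m) Filter.atTop (nhds 0) := by
        have := hx.sub_const m
        simpa [m] using this
      have := (h4.const_mul ε⁻¹).add
        (tendsto_const_div_atTop_nhds_zero_nat (k - ε⁻¹ * (psum x k - m * k)))
      simpa using this
    · push Not at hc
      have : ∀ n : ℕ, (∑ k ∈ Finset.range n, I k x) / n = 0 := fun n => by
        rw [Finset.sum_eq_zero fun k _ => by simp only [hI]; rw [if_neg (hc k)], zero_div]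
      simp only [this]
      exact tendsto_const_nhds
  have hdct := tendsto_integral_of_dominated_convergence (μ := iidLaw ν)
    (F := fun (n : ℕ) x => (∑ k ∈ Finset.range n, I k x) / n) (f := fun _ => 0) (fun _ => 1)
    (fun n => (by fun_prop : Measurable fun x => (∑ k ∈ Finset.range n, I k x) / n).aestronglyMeasurable)
    (integrable_const 1) (fun n => Filter.Eventually.of_forall fun x => by
      rw [Real.norm_of_nonneg (div_nonneg (Finset.sum_nonneg fun i _ => hI0 i x)
        (Nat.cast_nonneg n))]
      refine div_le_one_of_le₀ ?_ (Nat.cast_nonneg n)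
      calc ∑ i ∈ Finset.range n, I i x ≤ ∑ i ∈ Finset.range n, (1 : ℝ) :=
            Finset.sum_le_sum fun i _ => hI1 i x
        _ = n := by simp) hlim
  have hconst : ∀ᶠ n : ℕ in Filter.atTop, ∫ x, (∑ k ∈ Finset.range n, I k x) / n ∂iidLaw ν =
      (iidLaw ν).real {x | StaysFarAbove m ε x} := by
    filter_upwards [Filter.eventually_gt_atTop 0] with n hn
    have hnR : (n : ℝ) ≠ 0 := by positivity
    rw [integral_div, integral_finsetSum _ fun k _ => hIint k]
    simp only [hImean]
    rw [Finset.sum_const, Finset.card_range, nsmul_eq_mul]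
    field_simp
  rw [Filter.tendsto_congr' hconst] at hdct
  have h0 := tendsto_nhds_unique hdct tendsto_const_nhds
  rw [integral_zero] at h0
  exact (measureReal_eq_zero_iff (by simp)).1 h0.symm

/-- A walk does not stay above the line whose slope is its mean. -/
lemma iidLaw_staysAbove_eq_zero (hint : Integrable (fun y => y) ν) :
    iidLaw ν {x | StaysAbove (∫ y, y ∂ν) x} = 0 := by
  classical
  set m := ∫ y, y ∂ν
  by_contra hpos
  -- A first step of at least `m + ε` followed by a walk staying above the line is a null event. By
  -- independence, if staying above has positive probability, such a first step has probability 0;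
  -- yet staying above requires a first step greater than `m`.
  have hzero : ∀ n : ℕ, iidLaw ν {x | m + 1 / (n + 1 : ℝ) ≤ x 0} = 0 := fun n => by
    have hε : (0 : ℝ) < 1 / (n + 1 : ℝ) := by positivity
    set ε := 1 / (n + 1 : ℝ)
    have hs1 : MeasurableSet {x : ℕ → ℝ | m + ε ≤ x 0} :=
      measurableSet_le measurable_const (measurable_pi_apply 0)
    have h1 := lintegral_iidLaw_mul_shift (ν := ν) (n := 1)
      (f := {x : ℕ → ℝ | m + ε ≤ x 0}.indicator 1) (h := {x | StaysAbove m x}.indicator 1)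
      (measurable_one.indicator hs1) (measurable_one.indicator (measurableSet_staysAbove m))
      (fun x y hxy => by simp only [indicator_apply, mem_ofPred_eq, hxy 0 (by simp)]; rfl)
    rw [lintegral_indicator_one hs1, lintegral_indicator_one (measurableSet_staysAbove m)] at h1
    have h2 : ∫⁻ x, {x : ℕ → ℝ | m + ε ≤ x 0}.indicator 1 x *
        {x | StaysAbove m x}.indicator (1 : (ℕ → ℝ) → ℝ≥0∞) (fun i => x (1 + i)) ∂iidLaw ν ≤
        iidLaw ν {x | StaysFarAbove m ε x} := by
      rw [← lintegral_indicator_one (measurableSet_staysFarAbove m ε)]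
      refine lintegral_mono fun x => ?_
      simp only [indicator_apply, mem_ofPred_eq, Pi.one_apply]
      by_cases h3 : m + ε ≤ x 0
      · by_cases h4 : StaysAbove m fun i => x (1 + i)
        · rw [if_pos h3, if_pos h4, if_pos, one_mul]
          intro i hi
          obtain ⟨l, rfl⟩ : ∃ l, i = 1 + l := ⟨i - 1, by omega⟩
          have e1 : psum x 1 = x 0 := by rw [psum_succ, psum_zero, zero_add]
          rcases Nat.eq_zero_or_pos l with rfl | hl
          · simp only [add_zero, Nat.cast_one, mul_one, e1]; exact h3
          · have := h4 l hl
            rw [psum_shift, e1] at this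
            push_cast; linarith
        · simp [h4]
      · simp [h3]
    rw [h1, iidLaw_staysFarAbove_eq_zero hint hε, nonpos_iff_eq_zero, mul_eq_zero] at h2
    exact h2.resolve_right hpos
  refine hpos (measure_mono_null (fun x hx => ?_) (measure_iUnion_null hzero))
  have h1 : m < x 0 := by
    have := hx 1 one_pos
    rw [psum_succ, psum_zero] at this
    simpa using this
  obtain ⟨n, hn⟩ := exists_nat_one_div_lt (sub_pos.2 h1)
  rw [mem_iUnion]
  exact ⟨n, by rw [mem_ofPred_eq]; linarith⟩

/-- For a finite mean, the walk restarted at each `k` does not stay above the line of slope the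
mean; for an infinite mean every slope will do. -/
lemma ae_hasSlope (hneg : ∫⁻ y, ENNReal.ofReal (-y) ∂ν < ∞) :
    ∀ᵐ x ∂iidLaw ν, HasSlope (extendedExpectation ν fun y => y) (psum x) := by
  by_cases htop : extendedExpectation ν (fun y => y) = ⊤
  · filter_upwards [ae_forall_tendsto_sub_atTop hneg] with x hx
    exact ⟨hx, fun k => ⟨k + 1, by omega, by rw [htop]; exact le_top⟩⟩
  obtain ⟨hint, hM⟩ := integrable_of_extendedExpectation_ne_top hneg htop
  have h0 : ∀ᵐ x ∂iidLaw ν, ¬ StaysAbove (∫ y, y ∂ν) x :=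
    measure_eq_zero_iff_ae_notMem.1 (iidLaw_staysAbove_eq_zero hint)
  have h1 : ∀ᵐ x ∂iidLaw ν, ∀ k, ¬ StaysAbove (∫ y, y ∂ν) fun i => x (k + i) :=
    ae_all_iff.2 fun k => ae_iidLaw_comp ν (add_right_injective k) h0
  filter_upwards [ae_forall_tendsto_sub_atTop hneg, h1] with x hx hx1
  refine ⟨hx, fun k => ?_⟩
  have := hx1 k
  unfold StaysAbove at this
  push Not at this
  obtain ⟨i, hi, hle⟩ := this
  refine ⟨k + i, by omega, ?_⟩
  rw [psum_shift] at hle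
  rw [hM, EReal.coe_le_coe_iff]
  have hiR : (0 : ℝ) < i := by exact_mod_cast hi
  push_cast
  rw [add_sub_cancel_left, div_le_iff₀ hiR]
  exact hle

/-- The tilted walk attains its minimum once, when the slope is less than the mean. -/
lemma ae_exists_isGlobalArgmin [NullSingletonClass ν]
    (hneg : ∫⁻ y, ENNReal.ofReal (-y) ∂ν < ∞) {a : ℝ}
    (ha : (a : EReal) < extendedExpectation ν fun y => y) :
    ∀ᵐ x ∂iidLaw ν, ∃ n, IsGlobalArgmin a (psum x) n := by
  have hinj : ∀ᵐ x ∂iidLaw ν, ∀ p q : ℕ, p < q → psum x p - a * p ≠ psum x q - a * q := by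
    simp only [ae_all_iff]
    intro p q hpq
    have h := ae_ne_of_dependsOn (ν := ν) (u := p)
      (h := fun x => a * (q - p) - ∑ i ∈ (Finset.Ico p q).erase p, x i) (by fun_prop)
      (fun x y hxy => by
        simp only
        rw [Finset.sum_congr rfl fun i hi => hxy i fun (e : i = p) => (Finset.mem_erase.1 hi).1 e])
    filter_upwards [h] with x hx e
    apply hx
    have h1 := psum_sub_psum x hpq.le
    rw [← Finset.add_sum_erase _ _ (Finset.left_mem_Ico.2 hpq)] at h1
    linarith
  filter_upwards [ae_tendsto_sub_atTop hneg ha, hinj] with x h1 h2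
  exact exists_isGlobalArgmin h1 h2

end Asymptotics

/-! ### Laplace transforms of laws on `[0, ∞]^n` -/

/-- The function `exp (-r)` on `[0, ∞]`. -/
noncomputable def expNeg (r : ℝ≥0∞) : ℝ≥0∞ := EReal.exp (-(r : EReal))

@[fun_prop]
lemma continuous_expNeg : Continuous expNeg :=
  ENNReal.continuous_exp.comp (continuous_neg.comp continuous_coe_ennreal_ereal)

@[fun_prop]
lemma measurable_expNeg : Measurable expNeg := continuous_expNeg.measurable

@[simp]
lemma expNeg_zero : expNeg 0 = 1 := by simp [expNeg]

lemma expNeg_add (a b : ℝ≥0∞) : expNeg (a + b) = expNeg a * expNeg b := by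
  unfold expNeg
  rw [← EReal.exp_add, EReal.coe_ennreal_add, EReal.neg_add (.inl (EReal.coe_ennreal_ne_bot a))
    (.inr (EReal.coe_ennreal_ne_bot b)), sub_eq_add_neg]

lemma expNeg_le_one (r : ℝ≥0∞) : expNeg r ≤ 1 := by
  unfold expNeg
  rw [EReal.exp_le_one_iff, EReal.neg_le, neg_zero]
  exact EReal.coe_ennreal_nonneg r

lemma expNeg_ne_top (r : ℝ≥0∞) : expNeg r ≠ ∞ := ((expNeg_le_one r).trans_lt ENNReal.one_lt_top).ne

lemma expNeg_injective : Function.Injective expNeg := fun a b h => by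
  simpa using EReal.exp_strictMono.injective h

lemma expNeg_eq_ofReal {r : ℝ≥0∞} (hr : r ≠ ∞) : expNeg r = ENNReal.ofReal (Real.exp (-r.toReal)) := by
  unfold expNeg
  conv_lhs => rw [← ENNReal.ofReal_toReal hr]
  rw [EReal.coe_ennreal_ofReal, max_eq_left ENNReal.toReal_nonneg, ← EReal.coe_neg, EReal.exp_coe]

lemma expNeg_sum {ι : Type*} (s : Finset ι) (f : ι → ℝ≥0∞) :
    expNeg (∑ i ∈ s, f i) = ∏ i ∈ s, expNeg (f i) := by
  classical
  induction s using Finset.induction_on with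
  | empty => simp
  | insert a s ha ih => rw [Finset.sum_insert ha, Finset.prod_insert ha, expNeg_add, ih]

section Uniqueness

variable {ι : Type*} [Fintype ι]

/-- The exponential of a nonpositive linear form on `[0, ∞]^n`. -/
noncomputable def expMonomial (k : ι → ℕ) : BoundedContinuousFunction (ι → ℝ≥0∞) ℝ :=
  BoundedContinuousFunction.mkOfCompact
    ⟨fun x => (expNeg (∑ i, (k i : ℝ≥0∞) * x i)).toReal, by
      refine ENNReal.continuousOn_toReal.comp_continuous (continuous_expNeg.comp ?_)
        (fun x => expNeg_ne_top _)
      exact continuous_finsetSum _ fun i _ =>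
        (ENNReal.continuous_const_mul (ENNReal.natCast_ne_top _)).comp (continuous_apply i)⟩

lemma expMonomial_apply (k : ι → ℕ) (x : ι → ℝ≥0∞) :
    expMonomial k x = (expNeg (∑ i, (k i : ℝ≥0∞) * x i)).toReal := rfl

lemma expMonomial_zero : expMonomial (0 : ι → ℕ) = 1 := by
  ext x; simp [expMonomial_apply]

lemma expMonomial_mul (k l : ι → ℕ) : expMonomial k * expMonomial l = expMonomial (k + l) := by
  ext x
  rw [BoundedContinuousFunction.mul_apply, expMonomial_apply, expMonomial_apply, expMonomial_apply,
    ← ENNReal.toReal_mul, ← expNeg_add, ← Finset.sum_add_distrib]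
  simp only [Pi.add_apply, Nat.cast_add, add_mul]

/-- A finite measure on `[0, ∞]^n` is determined by its Laplace transform at integer points. -/
lemma ext_of_lintegral_expNeg {μ μ' : Measure (ι → ℝ≥0∞)} [IsFiniteMeasure μ] [IsFiniteMeasure μ']
    (h : ∀ k : ι → ℕ, ∫⁻ x, expNeg (∑ i, (k i : ℝ≥0∞) * x i) ∂μ =
      ∫⁻ x, expNeg (∑ i, (k i : ℝ≥0∞) * x i) ∂μ') : μ = μ' := by
  classical
  have hmon : ∀ (ρ : Measure (ι → ℝ≥0∞)) [IsFiniteMeasure ρ] (k : ι → ℕ),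
      ∫ x, expMonomial k x ∂ρ = (∫⁻ x, expNeg (∑ i, (k i : ℝ≥0∞) * x i) ∂ρ).toReal := by
    intro ρ _ k
    simp only [expMonomial_apply]
    exact integral_toReal (Measurable.aemeasurable (by fun_prop)) (Filter.Eventually.of_forall fun x =>
      (expNeg_ne_top _).lt_top)
  let A : StarSubalgebra ℝ (BoundedContinuousFunction (ι → ℝ≥0∞) ℝ) :=
    { Algebra.adjoin ℝ (range (expMonomial (ι := ι))) with
      star_mem' := fun {f} hf => by
        have : star f = f := by ext x; simp
        rwa [this] }
  have hA : ∀ {f}, f ∈ A ↔ f ∈ Algebra.adjoin ℝ (range (expMonomial (ι := ι))) := Iff.rfl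
  refine ext_of_forall_mem_subalgebra_integral_eq_of_polish (𝕜 := ℝ) (A := A) ?_ fun g hg => ?_
  -- A single coordinate separates points, and `expNeg` is injective on all of `[0, ∞]`, including
  -- `∞`.
  · intro x y hxy
    obtain ⟨i, hi⟩ := Function.ne_iff.1 hxy
    refine ⟨_, ⟨_, ⟨expMonomial (Pi.single i 1),
      hA.2 (Algebra.subset_adjoin (mem_range_self _)), rfl⟩, rfl⟩, ?_⟩
    change expMonomial (Pi.single i 1) x ≠ expMonomial (Pi.single i 1) y
    intro he
    rw [expMonomial_apply, expMonomial_apply,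
      ENNReal.toReal_eq_toReal_iff' (expNeg_ne_top _) (expNeg_ne_top _)] at he
    have hs : ∀ z : ι → ℝ≥0∞, ∑ l, ((Pi.single i 1 : ι → ℕ) l : ℝ≥0∞) * z l = z i := fun z => by
      rw [Finset.sum_eq_single i] <;> simp +contextual
    rw [hs, hs] at he
    exact hi (expNeg_injective he)
  -- Products of these exponentials are again such exponentials, so the algebra is their linear span
  -- and the hypothesis extends by linearity.
  · rw [hA, ← Subalgebra.mem_toSubmodule, Algebra.adjoin_eq_span] at hg
    have hcl : ∀ f ∈ Submonoid.closure (range (expMonomial (ι := ι))),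
        f ∈ range (expMonomial (ι := ι)) := fun f hf => by
      induction hf using Submonoid.closure_induction with
      | mem f hf => exact hf
      | one => exact ⟨0, expMonomial_zero⟩
      | mul f g _ _ hf hg =>
        obtain ⟨k, rfl⟩ := hf
        obtain ⟨l, rfl⟩ := hg
        exact ⟨k + l, (expMonomial_mul k l).symm⟩
    induction hg using Submodule.span_induction with
    | mem f hf =>
      obtain ⟨k, rfl⟩ := hcl f hf
      rw [hmon, hmon, h]
    | zero => simp
    | add f g _ _ hf hg =>
      simp only [BoundedContinuousFunction.add_apply]
      rw [integral_add (f.integrable _) (g.integrable _), integral_add (f.integrable _)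
        (g.integrable _), hf, hg]
    | smul c f _ hf =>
      simp only [BoundedContinuousFunction.coe_smul]
      rw [integral_smul, integral_smul, hf]

end Uniqueness

instance (r : ℝ≥0∞) : IsProbabilityMeasure (extendedPoisson r) := by
  unfold extendedPoisson
  split_ifs
  · infer_instance
  · exact Measure.isProbabilityMeasure_map Measurable.of_discrete.aemeasurable

/-- The Laplace transform of the Poisson distribution. -/
lemma lintegral_expNeg_extendedPoisson (r : ℝ≥0∞) (k : ℕ) :
    ∫⁻ x, expNeg (k * x) ∂extendedPoisson r = expNeg ((1 - expNeg k) * r) := by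
  unfold extendedPoisson
  split_ifs with hr
  · rw [lintegral_dirac, hr]
    -- With `r = ∞`, both sides are 1 for `k = 0` since `0 * ∞ = 0`, and both are `expNeg ∞` for `k
    -- > 0`.
    rcases Nat.eq_zero_or_pos k with rfl | hk
    · simp
    · have h1 : expNeg k ≠ 1 := fun h => by
        rw [← expNeg_zero] at h
        have := expNeg_injective h
        simp at this; omega
      rw [ENNReal.mul_top (by simp; omega), ENNReal.mul_top (tsub_pos_of_lt
        ((expNeg_le_one k).lt_of_ne h1)).ne']
  · have hq : expNeg k = ENNReal.ofReal (Real.exp (-k)) := by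
      rw [expNeg_eq_ofReal (ENNReal.natCast_ne_top k), ENNReal.toReal_natCast]
    rw [lintegral_map (by fun_prop) Measurable.of_discrete, poissonMeasure, lintegral_sum_measure]
    simp only [lintegral_smul_measure, lintegral_dirac, smul_eq_mul]
    set ρ := r.toNNReal
    have hterm : ∀ n : ℕ, ENNReal.ofReal (Real.exp (-ρ) * (ρ : ℝ) ^ n / n.factorial) *
        expNeg (k * n) = ENNReal.ofReal (Real.exp (-ρ) *
          ((ρ * Real.exp (-k)) ^ n / n.factorial)) := fun n => by
      have e : (k : ℝ≥0∞) * n = ((k * n : ℕ) : ℝ≥0∞) := by push_cast; rfl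
      rw [e, expNeg_eq_ofReal (ENNReal.natCast_ne_top _), ENNReal.toReal_natCast,
        ← ENNReal.ofReal_mul (by positivity)]
      congr 1
      have : Real.exp (-((k * n : ℕ) : ℝ)) = Real.exp (-k) ^ n := by
        rw [← Real.exp_nat_mul]; congr 1; push_cast; ring
      rw [this, mul_pow]; ring
    simp only [hterm]
    have hs : HasSum (fun n : ℕ => Real.exp (-ρ) * (((ρ : ℝ) * Real.exp (-k)) ^ n / n.factorial))
        (Real.exp (-ρ) * Real.exp (ρ * Real.exp (-k))) := by
      have := NormedSpace.expSeries_div_hasSum_exp ((ρ : ℝ) * Real.exp (-k))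
      rw [← Real.exp_eq_exp_ℝ] at this
      exact this.mul_left _
    rw [← ENNReal.ofReal_tsum_of_nonneg (fun n => by positivity) hs.summable, hs.tsum_eq,
      expNeg_eq_ofReal (ENNReal.mul_ne_top (ne_top_of_le_ne_top ENNReal.one_ne_top tsub_le_self) hr),
      ← Real.exp_add, ENNReal.toReal_mul, hq, ENNReal.toReal_sub_of_le (by
        rw [← hq]; exact expNeg_le_one _) ENNReal.one_ne_top, ENNReal.toReal_one,
      ENNReal.toReal_ofReal (Real.exp_pos _).le]
    congr 2
    change _ = -((1 - Real.exp (-(k : ℝ))) * (ρ : ℝ))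
    ring

/-- A random vector with the Laplace transform of independent Poisson variables. -/
lemma map_eq_pi_extendedPoisson {Ω ι : Type*} [MeasurableSpace Ω] {P : Measure Ω}
    [IsProbabilityMeasure P] [Fintype ι] {Y : Ω → ι → ℝ≥0∞} (hY : AEMeasurable Y P)
    (r : ι → ℝ≥0∞)
    (h : ∀ k : ι → ℕ, ∫⁻ ω, expNeg (∑ i, (k i : ℝ≥0∞) * Y ω i) ∂P =
      expNeg (∑ i, (1 - expNeg (k i)) * r i)) :
    P.map Y = Measure.pi fun i => extendedPoisson (r i) := by
  have : IsProbabilityMeasure (P.map Y) := Measure.isProbabilityMeasure_map hY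
  refine ext_of_lintegral_expNeg fun k => ?_
  rw [lintegral_map' (Measurable.aemeasurable (by fun_prop)) hY, h k]
  simp only [expNeg_sum]
  have hind : iIndepFun (fun (i : ι) (x : ι → ℝ≥0∞) => expNeg (k i * x i))
      (Measure.pi fun i => extendedPoisson (r i)) :=
    iIndepFun_pi (X := fun i y => expNeg (k i * y)) fun i => by fun_prop
  rw [lintegral_prod_eq_prod_lintegral_of_indepFun Finset.univ _ hind fun i => by fun_prop]
  refine Finset.prod_congr rfl fun i _ => ?_
  rw [← lintegral_expNeg_extendedPoisson (r i) (k i)]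
  exact ((measurePreserving_eval (fun i => extendedPoisson (r i)) i).lintegral_comp
    (f := fun y => expNeg (k i * y)) (by fun_prop)).symm

/-! ### The point process of strict faces -/

open Classical in
/-- The point process of lengths and increments of the strict faces. -/
noncomputable def strictFaceMeasure (s : ℕ → ℝ) : Measure (ℕ+ × ℝ) :=
  Measure.sum fun p : ℕ × ℕ+ =>
    if IsStrictFace univ s p.1 p.2 then Measure.dirac (p.2, s (p.1 + p.2) - s p.1) else 0

/-- Strict faces are cut out by countably many inequalities, so the right side is a measurable
function of the walk. -/
lemma HasSlope.faceProcess_eq {M : EReal} {s : ℕ → ℝ} (hs : HasSlope M s) (hg : IsGeneric s) :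
    faceProcess s = strictFaceMeasure s := by
  ext A hA
  rw [faceProcess, strictFaceMeasure, Measure.sum_apply _ hA, Measure.sum_apply _ hA,
    tsum_subtype (faces s) fun p => Measure.dirac (p.2, s (p.1 + p.2) - s p.1) A, hs.faces_eq hg]
  refine tsum_congr fun p => ?_
  by_cases h : IsStrictFace univ s p.1 p.2
  · rw [if_pos h, indicator_of_mem (show p ∈ {p : ℕ × ℕ+ | IsStrictFace univ s p.1 p.2} from h)]
  · rw [if_neg h, indicator_of_notMem (show p ∉ {p : ℕ × ℕ+ | IsStrictFace univ s p.1 p.2} from h)]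
    rfl

open Classical in
lemma lintegral_strictFaceMeasure (s : ℕ → ℝ) {F : ℕ+ × ℝ → ℝ≥0∞} (hF : Measurable F) :
    ∫⁻ q, F q ∂strictFaceMeasure s = ∑' p : ℕ × ℕ+,
      if IsStrictFace univ s p.1 p.2 then F (p.2, s (p.1 + p.2) - s p.1) else 0 := by
  rw [strictFaceMeasure, lintegral_sum_measure]
  refine tsum_congr fun p => ?_
  split_ifs
  · rw [lintegral_dirac' _ hF]
  · simp

lemma measurable_strictFaceMeasure : Measurable fun x => strictFaceMeasure (psum x) := by
  classical
  refine Measure.measurable_of_measurable_coe _ fun A hA => ?_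
  have h : ∀ x, strictFaceMeasure (psum x) A = ∑' p : ℕ × ℕ+,
      if IsStrictFace univ (psum x) p.1 p.2 then
        A.indicator (1 : ℕ+ × ℝ → ℝ≥0∞) (p.2, psum x (p.1 + p.2) - psum x p.1) else 0 := fun x => by
    rw [← lintegral_strictFaceMeasure _ (measurable_one.indicator hA), lintegral_indicator_one hA]
  simp only [h]
  exact Measurable.tsum fun p => Measurable.ite (measurableSet_isStrictFace _ _ _)
    ((measurable_one.indicator hA).comp (by fun_prop)) measurable_const

/-- The lengths and increments of slope less than `m`. -/
def slopeSet (m : EReal) : Set (ℕ+ × ℝ) := {q | ((q.2 / (q.1 : ℕ) : ℝ) : EReal) < m}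

lemma measurableSet_slopeSet (m : EReal) : MeasurableSet (slopeSet m) := by
  refine measurableSet_lt (measurable_coe_real_ereal.comp (measurable_snd.div ?_)) measurable_const
  exact (Measurable.of_discrete (f := fun j : ℕ+ => ((j : ℕ) : ℝ))).comp measurable_fst

lemma mem_slopeSet_coe {a : ℝ} {q : ℕ+ × ℝ} :
    q ∈ slopeSet (a : EReal) ↔ q.2 < a * (q.1 : ℕ) := by
  have : (0 : ℝ) < (q.1 : ℕ) := by exact_mod_cast q.1.pos
  rw [slopeSet, mem_ofPred_eq, EReal.coe_lt_coe_iff, div_lt_iff₀ this]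

lemma IsGlobalArgmin.lintegral_strictFaceMeasure {a : ℝ} {s : ℕ → ℝ} {n : ℕ}
    (hn : IsGlobalArgmin a s n) {F : ℕ+ × ℝ → ℝ≥0∞} (hF : Measurable F) :
    ∫⁻ q in slopeSet a, F q ∂strictFaceMeasure s =
      ∑ p ∈ finiteFaces n s, F (p.2.toPNat', s (p.1 + p.2) - s p.1) := by
  classical
  have hcoe : ∀ p ∈ finiteFaces n s, (p.2.toPNat' : ℕ) = p.2 := fun p hp =>
    Nat.succ_pred_eq_of_pos (mem_finiteFaces.1 hp).1
  rw [← lintegral_indicator (measurableSet_slopeSet _),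
    RandomWalkMinorant.lintegral_strictFaceMeasure _ (hF.indicator (measurableSet_slopeSet _)),
    tsum_eq_sum (s := (finiteFaces n s).image fun p => (p.1, p.2.toPNat'))]
  · rw [Finset.sum_image]
    · refine Finset.sum_congr rfl fun p hp => ?_
      have h := (hn.mem_finiteFaces_iff (k := p.1) (mem_finiteFaces.1 hp).1).1 hp
      simp only [hcoe p hp]
      rw [if_pos h.1, indicator_of_mem]
      rw [mem_slopeSet_coe]
      simp only [hcoe p hp]
      exact h.2
    · intro p hp p' hp' e
      simp only [Prod.mk.injEq] at e
      refine Prod.ext e.1 ?_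
      rw [← hcoe p hp, ← hcoe p' hp', e.2]
  · rintro ⟨k, j⟩ hp
    rw [ite_eq_right_iff]
    intro hf
    rw [indicator_of_notMem]
    intro hmem
    rw [mem_slopeSet_coe] at hmem
    refine hp (Finset.mem_image.2 ⟨(k, j), (hn.mem_finiteFaces_iff j.pos).2 ⟨hf, hmem⟩, ?_⟩)
    simp

lemma lintegral_faceIntensity {Ω : Type*} [MeasurableSpace Ω] {P : Measure Ω} {X : ℕ → Ω → ℝ}
    (hX : ∀ i, Measurable (X i)) (m : EReal) {H : ℕ+ × ℝ → ℝ≥0∞} (hH : Measurable H) :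
    ∫⁻ q, H q ∂faceIntensity P X m =
      ∑' j : ℕ+, ((j : ℕ) : ℝ≥0∞)⁻¹ *
        ∫⁻ ω, (slopeSet m).indicator H (j, walk X j ω) ∂P := by
  have hW : ∀ j, Measurable (walk X j) := fun j => by unfold walk; fun_prop
  rw [faceIntensity, lintegral_sum_measure]
  refine tsum_congr fun j => ?_
  have hset : MeasurableSet {x : ℝ | ((x / (j : ℕ) : ℝ) : EReal) < m} :=
    (measurable_prodMk_left : Measurable fun x : ℝ => (j, x)) (measurableSet_slopeSet m)
  rw [lintegral_map hH measurable_prodMk_left, lintegral_smul_measure, smul_eq_mul,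
    ← lintegral_indicator hset, lintegral_map (f := {x : ℝ | ((x / (j : ℕ) : ℝ) : EReal) <
      m}.indicator fun x => H (j, x)) ((hH.comp measurable_prodMk_left).indicator hset) (hW j)]
  rfl

/-- The intensity is the restriction of the one with no bound on the slope. -/
lemma setLIntegral_faceIntensity_top {Ω : Type*} [MeasurableSpace Ω] {P : Measure Ω}
    {X : ℕ → Ω → ℝ} (hX : ∀ i, Measurable (X i)) (m : EReal) {H : ℕ+ × ℝ → ℝ≥0∞}
    (hH : Measurable H) :
    ∫⁻ q in slopeSet m, H q ∂faceIntensity P X ⊤ = ∫⁻ q, H q ∂faceIntensity P X m := by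
  have huniv : slopeSet ⊤ = univ := eq_univ_of_forall fun q => EReal.coe_lt_top _
  rw [← lintegral_indicator (measurableSet_slopeSet m), lintegral_faceIntensity hX _ hH,
    lintegral_faceIntensity hX _ (hH.indicator (measurableSet_slopeSet m)), huniv]
  simp

section Laplace

variable {ν : Measure ℝ} [IsProbabilityMeasure ν] [NullSingletonClass ν]

/-- With weight `expNeg (F (j, x))`, the product over the faces is the exponential of minus the
integral of `F` against the process. -/
lemma laplace_slope_lt (hneg : ∫⁻ y, ENNReal.ofReal (-y) ∂ν < ∞) {a : ℝ}
    (ha : (a : EReal) < extendedExpectation ν fun y => y) {F : ℕ+ × ℝ → ℝ≥0∞} (hF : Measurable F) :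
    ∫⁻ x, expNeg (∫⁻ q in slopeSet a, F q ∂strictFaceMeasure (psum x)) ∂iidLaw ν =
      expNeg (∫⁻ q, (1 - expNeg (F q)) ∂faceIntensity (iidLaw ν) (fun i x => x i) a) := by
  have h := lintegral_faces_slope_lt (ae_exists_isGlobalArgmin hneg ha)
    (g := fun j x => expNeg (F (j.toPNat', x))) (fun j => by fun_prop)
    (fun j x => expNeg_le_one _)
    (R := fun x => expNeg (∫⁻ q in slopeSet a, F q ∂strictFaceMeasure (psum x)))
    (fun x n hn => by
      rw [hn.lintegral_strictFaceMeasure hF, expNeg_sum, faceProd])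
  rw [h.2, ← expNeg_eq_ofReal h.1, lintegral_faceIntensity (fun i => measurable_pi_apply i) _
    (by fun_prop)]
  congr 1
  have hsucc := tsum_pnat_eq_tsum_succ (f := fun k : ℕ => (k : ℝ≥0∞)⁻¹ *
    ∫⁻ x, slopeCut a (fun j y => 1 - expNeg (F (j.toPNat', y))) k (psum x k) ∂iidLaw ν)
  push_cast at hsucc
  rw [← hsucc]
  refine tsum_congr fun j => ?_
  congr 1
  refine lintegral_congr fun x => ?_
  have hw : walk (fun i (x : ℕ → ℝ) => x i) j x = psum x j := rfl
  have hiff : (j, psum x j) ∈ slopeSet (a : EReal) ↔ psum x j < a * (j : ℕ) := mem_slopeSet_coe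
  rw [hw, slopeCut]
  split_ifs with h
  · rw [indicator_of_mem (hiff.2 h), PNat.coe_toPNat']
  · rw [indicator_of_notMem fun hm => h (hiff.1 hm)]

lemma exists_real_seq {M : EReal} (hM : M ≠ ⊥) :
    ∃ a : ℕ → ℝ, Monotone a ∧ (∀ n, (a n : EReal) < M) ∧ ∀ c : ℝ, (c : EReal) < M → ∃ n, c < a n := by
  obtain ⟨u, hu, hmem, hlim⟩ := exists_seq_strictMono_tendsto' (bot_lt_iff_ne_bot.2 hM)
  have hcoe : ∀ n, (((u n).toReal : ℝ) : EReal) = u n := fun n =>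
    EReal.coe_toReal ((hmem n).2.trans_le le_top).ne (hmem n).1.ne'
  refine ⟨fun n => (u n).toReal, fun m n hmn => ?_, fun n => by rw [hcoe]; exact (hmem n).2,
    fun c hc => ?_⟩
  · rw [← EReal.coe_le_coe_iff, hcoe, hcoe]; exact hu.monotone hmn
  · obtain ⟨n, hn⟩ := (hlim.eventually_const_lt hc).exists
    exact ⟨n, by rw [← EReal.coe_lt_coe_iff, hcoe]; exact hn⟩

lemma tendsto_setLIntegral_slopeSet {M : EReal} {a : ℕ → ℝ} (hmono : Monotone a)
    (ha : ∀ n, (a n : EReal) < M) (hc : ∀ c : ℝ, (c : EReal) < M → ∃ n, c < a n)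
    (μ : Measure (ℕ+ × ℝ)) (F : ℕ+ × ℝ → ℝ≥0∞) :
    Filter.Tendsto (fun n => ∫⁻ q in slopeSet (a n), F q ∂μ) Filter.atTop
      (nhds (∫⁻ q in slopeSet M, F q ∂μ)) := by
  have hm : Monotone fun n => slopeSet (a n : EReal) := fun m n hmn q hq =>
    lt_of_lt_of_le hq (EReal.coe_le_coe_iff.2 (hmono hmn))
  have hU : slopeSet M = ⋃ n, slopeSet (a n : EReal) := by
    ext q
    rw [mem_iUnion]
    constructor
    · intro hq
      obtain ⟨n, hn⟩ := hc _ hq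
      exact ⟨n, EReal.coe_lt_coe_iff.2 hn⟩
    · rintro ⟨n, hn⟩
      exact lt_trans hn (ha n)
  rw [hU, setLIntegral_iUnion_of_directed F hm.directed_le]
  exact tendsto_atTop_iSup fun m n hmn => lintegral_mono_set (hm hmn)

/-- The Laplace functional of the process of faces. -/
lemma laplace_strictFaceMeasure (hneg : ∫⁻ y, ENNReal.ofReal (-y) ∂ν < ∞)
    {F : ℕ+ × ℝ → ℝ≥0∞} (hF : Measurable F) :
    ∫⁻ x, expNeg (∫⁻ q, F q ∂strictFaceMeasure (psum x)) ∂iidLaw ν =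
      expNeg (∫⁻ q, (1 - expNeg (F q)) ∂faceIntensity (iidLaw ν) (fun i x => x i)
        (extendedExpectation ν fun y => y)) := by
  set M := extendedExpectation ν fun y => y
  obtain ⟨a, hmono, ha, hc⟩ := exists_real_seq (extendedExpectation_ne_bot hneg)
  have hX : ∀ i : ℕ, Measurable fun x : ℕ → ℝ => x i := fun i => measurable_pi_apply i
  have hH : Measurable fun q => 1 - expNeg (F q) := by fun_prop
  -- Almost surely all faces have slope less than `M`, so the limit of the cuts loses no face.
  have hfull : ∀ᵐ x ∂iidLaw ν, ∫⁻ q in slopeSet M, F q ∂strictFaceMeasure (psum x) =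
      ∫⁻ q, F q ∂strictFaceMeasure (psum x) := by
    filter_upwards [ae_hasSlope hneg] with x hx
    rw [← lintegral_indicator (measurableSet_slopeSet _), lintegral_strictFaceMeasure _ hF,
      lintegral_strictFaceMeasure _ (hF.indicator (measurableSet_slopeSet _))]
    refine tsum_congr fun p => ?_
    split_ifs with h
    · rw [indicator_of_mem]
      exact hx.slope_lt p.2.pos h
    · rfl
  have hmeas : ∀ n, Measurable fun x =>
      expNeg (∫⁻ q in slopeSet (a n), F q ∂strictFaceMeasure (psum x)) := fun n => by
    simp only [← lintegral_indicator (measurableSet_slopeSet _)]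
    exact measurable_expNeg.comp ((Measure.measurable_lintegral
      (hF.indicator (measurableSet_slopeSet _))).comp measurable_strictFaceMeasure)
  have h1 : Filter.Tendsto (fun n => ∫⁻ x, expNeg (∫⁻ q in slopeSet (a n), F q
      ∂strictFaceMeasure (psum x)) ∂iidLaw ν) Filter.atTop
      (nhds (∫⁻ x, expNeg (∫⁻ q, F q ∂strictFaceMeasure (psum x)) ∂iidLaw ν)) := by
    refine tendsto_lintegral_of_dominated_convergence (fun _ => 1) hmeas
      (fun n => Filter.Eventually.of_forall fun x => expNeg_le_one _) (by simp) ?_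
    filter_upwards [hfull] with x hx
    rw [← hx]
    exact (continuous_expNeg.tendsto _).comp (tendsto_setLIntegral_slopeSet hmono ha hc _ F)
  have h2 : Filter.Tendsto (fun n => ∫⁻ x, expNeg (∫⁻ q in slopeSet (a n), F q
      ∂strictFaceMeasure (psum x)) ∂iidLaw ν) Filter.atTop
      (nhds (expNeg (∫⁻ q, (1 - expNeg (F q)) ∂faceIntensity (iidLaw ν) (fun i x => x i) M))) := by
    simp only [laplace_slope_lt hneg (ha _) hF, ← setLIntegral_faceIntensity_top hX _ hH]
    exact (continuous_expNeg.tendsto _).comp (tendsto_setLIntegral_slopeSet hmono ha hc _ _)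
  exact tendsto_nhds_unique h1 h2

/-- The joint law of the numbers of faces in disjoint sets. -/
lemma map_strictFaceMeasure (hneg : ∫⁻ y, ENNReal.ofReal (-y) ∂ν < ∞) {n : ℕ}
    {A : Fin n → Set (ℕ+ × ℝ)} (hA : ∀ i, MeasurableSet (A i))
    (hd : Pairwise fun i j => Disjoint (A i) (A j)) :
    (iidLaw ν).map (fun x i => strictFaceMeasure (psum x) (A i)) =
      Measure.pi fun i => extendedPoisson (faceIntensity (iidLaw ν) (fun i x => x i)
        (extendedExpectation ν fun y => y) (A i)) := by
  classical
  have hY : Measurable fun x i => strictFaceMeasure (psum x) (A i) := measurable_pi_lambda _ fun i =>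
    (Measure.measurable_coe (hA i)).comp measurable_strictFaceMeasure
  refine map_eq_pi_extendedPoisson hY.aemeasurable _ fun k => ?_
  -- Integrating this combination of indicators gives the linear form of the counts. By
  -- disjointness, at most one term is nonzero at each point, so `1 - expNeg` acts on it term by
  -- term.
  have hF : Measurable fun q => ∑ i, (k i : ℝ≥0∞) * (A i).indicator (1 : ℕ+ × ℝ → ℝ≥0∞) q :=
    Finset.measurable_sum _ fun i _ => (measurable_one.indicator (hA i)).const_mul _
  have hsum : ∀ (μ : Measure (ℕ+ × ℝ)) (c : Fin n → ℝ≥0∞),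
      ∫⁻ q, ∑ i, c i * (A i).indicator (1 : ℕ+ × ℝ → ℝ≥0∞) q ∂μ = ∑ i, c i * μ (A i) := by
    intro μ c
    rw [lintegral_finsetSum _ fun i _ => (measurable_one.indicator (hA i)).const_mul _]
    refine Finset.sum_congr rfl fun i _ => ?_
    rw [lintegral_const_mul _ (measurable_one.indicator (hA i)), lintegral_indicator_one (hA i)]
  have h := laplace_strictFaceMeasure hneg hF
  simp only [hsum] at h
  rw [h, ← hsum]
  congr 1
  refine lintegral_congr fun q => ?_
  by_cases hq : ∃ i, q ∈ A i
  · obtain ⟨i, hi⟩ := hq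
    have hne : ∀ l, l ≠ i → q ∉ A l := fun l hl hql => disjoint_left.1 (hd hl) hql hi
    rw [Finset.sum_eq_single i (fun l _ hl => by simp [hne l hl]) (by simp),
      Finset.sum_eq_single i (fun l _ hl => by simp [hne l hl]) (by simp)]
    simp [hi]
  · push Not at hq
    simp [hq]

end Laplace

end RandomWalkMinorant

/-! ### Transfer from sequence space to the given walk. -/

open RandomWalkMinorant

theorem mainTheorem9 {Ω : Type*} [MeasurableSpace Ω] (P : Measure Ω) [IsProbabilityMeasure P]
    (X : ℕ → Ω → ℝ) (hmeas : ∀ i, Measurable (X i))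
    (hindep : iIndepFun X P) (hident : ∀ i, IdentDistrib (X i) (X 0) P P)
    (hcont : ∀ x : ℝ, P {ω | X 0 ω = x} = 0)
    (hmean : ∫⁻ ω, ENNReal.ofReal (-X 0 ω) ∂P < ∞) :
    (∀ᵐ ω ∂P, RandomWalkMinorant.IsGreatestConvexMinorant
      (fun n => RandomWalkMinorant.walk X n ω)
      (RandomWalkMinorant.convexMinorant (fun n => RandomWalkMinorant.walk X n ω))) ∧
    RandomWalkMinorant.IsPoissonPointProcess P
      (RandomWalkMinorant.faceIntensity P X (RandomWalkMinorant.extendedExpectation P (X 0)))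
      (fun ω => RandomWalkMinorant.faceProcess (fun n => RandomWalkMinorant.walk X n ω)) := by
  set ν : Measure ℝ := P.map (X 0) with hν
  have hprob : IsProbabilityMeasure ν := Measure.isProbabilityMeasure_map (hmeas 0).aemeasurable
  have hna : NullSingletonClass ν :=
    ⟨fun x => by rw [hν, Measure.map_apply (hmeas 0) (measurableSet_singleton x)]; exact hcont x⟩
  have hT : Measurable fun ω i => X i ω := measurable_pi_lambda _ hmeas
  have hlaw : P.map (fun ω i => X i ω) = iidLaw ν := by
    rw [hindep.map_fun_eq_infinitePi_map hmeas, iidLaw]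
    congr 1
    funext i
    exact (hident i).map_eq
  have hneg : ∫⁻ y, ENNReal.ofReal (-y) ∂ν < ∞ := by
    rwa [hν, lintegral_map (by fun_prop) (hmeas 0)]
  have hexp : extendedExpectation P (X 0) = extendedExpectation ν fun y => y := by
    rw [extendedExpectation, extendedExpectation, hν, lintegral_map (by fun_prop) (hmeas 0),
      lintegral_map (by fun_prop) (hmeas 0)]
  have hint : ∀ m, faceIntensity P X m = faceIntensity (iidLaw ν) (fun i x => x i) m := fun m => by
    have hwalk : ∀ j, P.map (walk X j) = (iidLaw ν).map (walk (fun i (x : ℕ → ℝ) => x i) j) := fun j => by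
      rw [← hlaw]
      exact (Measure.map_map (measurable_psum j) hT).symm
    simp only [faceIntensity, hwalk]
  have hae : ∀ᵐ ω ∂P, HasSlope (extendedExpectation ν fun y => y) (fun n => walk X n ω) ∧
      IsGeneric fun n => walk X n ω := by
    have h := (ae_hasSlope hneg).and (ae_isGeneric ν)
    rw [← hlaw] at h
    exact ae_of_ae_map hT.aemeasurable h
  have hface : ∀ᵐ ω ∂P, faceProcess (fun n => walk X n ω) =
      strictFaceMeasure (psum fun i => X i ω) :=
    hae.mono fun ω h => h.1.faceProcess_eq h.2
  -- The process is a measurable function of the walk only off the null set where genericity or the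
  -- asymptotic slope fails.
  have haem : AEMeasurable (fun ω => faceProcess fun n => walk X n ω) P :=
    ⟨_, measurable_strictFaceMeasure.comp hT, hface⟩
  have haemA : ∀ A : Set (ℕ+ × ℝ), MeasurableSet A →
      AEMeasurable (fun ω => faceProcess (fun n => walk X n ω) A) P := fun A hA =>
    (Measure.measurable_coe hA).comp_aemeasurable haem
  have hjoint : ∀ (n : ℕ) (A : Fin n → Set (ℕ+ × ℝ)), (∀ i, MeasurableSet (A i)) →
      Pairwise (fun i j => Disjoint (A i) (A j)) →
      P.map (fun ω i => faceProcess (fun n => walk X n ω) (A i)) = Measure.pi fun i =>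
        extendedPoisson (faceIntensity P X (extendedExpectation P (X 0)) (A i)) := by
    intro n A hA hd
    have hY : Measurable fun (x : ℕ → ℝ) i => strictFaceMeasure (psum x) (A i) :=
      measurable_pi_lambda _ fun i =>
        (Measure.measurable_coe (hA i)).comp measurable_strictFaceMeasure
    rw [hint, hexp, ← map_strictFaceMeasure hneg hA hd, ← hlaw, Measure.map_map hY hT]
    refine Measure.map_congr (hface.mono fun ω h => ?_)
    funext i
    simp only [h, Function.comp_apply]
  have hlawA : ∀ A : Set (ℕ+ × ℝ), MeasurableSet A →
      P.map (fun ω => faceProcess (fun n => walk X n ω) A) =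
        extendedPoisson (faceIntensity P X (extendedExpectation P (X 0)) A) := by
    intro A hA
    -- The law of one count is the joint law for a family of one set.
    have h := congrArg (Measure.map fun y : Fin 1 → ℝ≥0∞ => y 0)
      (hjoint 1 (fun _ => A) (fun _ => hA) fun i j hij => absurd (Subsingleton.elim i j) hij)
    rw [AEMeasurable.map_map_of_aemeasurable (measurable_pi_apply 0).aemeasurable
      (aemeasurable_pi_lambda _ fun _ => haemA A hA)] at h
    exact h.trans (measurePreserving_eval (fun _ : Fin 1 =>
      extendedPoisson (faceIntensity P X (extendedExpectation P (X 0)) A)) 0).map_eq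
  refine ⟨hae.mono fun ω h => h.1.isGreatestConvexMinorant h.2, haem,
    fun A hA => ⟨haemA A hA, hlawA A hA⟩, fun n A hA hd => ?_⟩
  -- Independence holds because the joint law is the product of laws just identified as the
  -- marginals.
  rw [iIndepFun_iff_map_fun_eq_pi_map fun i => haemA _ (hA i), hjoint n A hA hd]
  congr 1
  funext i
  exact (hlawA _ (hA i)).symm
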